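/- Let $B_1,B_2\subset\mathbb Z$ be finite sets with at least two elements each, and let $\mathbb C^{B_i}$ be the space of Laurent polynomials $f(x)=\sum_{b\in B_i}c_bx^b$. For $f\in\mathbb C^{B_i}$ and $x\in\mathbb{CP}^1$ let $\operatorname{ord}_x(f)$ be the multiplicity at $x$ of the section $\sum_{b\in B_i}c_b\,x^{b-\min B_i}y^{\max B_i-b}$ of $\mathcal O(\max B_i-\min B_i)$ on $\mathbb{CP}^1$, and put $\operatorname{ord}_x(f_1,f_2)=\min(\operatorname{ord}_x f_1,\operatorname{ord}_x f_2)$. For integers $j_0,j_\infty\ge 0$, $k\ge 0$ and $j^1_m,j^2_m\ge 1$ ($1\le m\le k$), let $$N_{j_0}^{j_\infty}\begin{pmatrix}j^1_1,\dots,j^1_k\\ j^2_1,\dots,j^2_k\end{pmatrix}\subset\mathbb C^{B_1}\times\mathbb C^{B_2}$$ be the set of pairs $(f_1,f_2)$ with $f_1\ne0$ and $f_2\neq 0$ such that $\operatorname{ord}_0(f_1,f_2)\ge j_0$, $\operatorname{ord}_\infty(f_1,f_2)\ge j_\infty$, and the system $f_1=f_2=0$ has $k$ distinct solutions $x_1,\dots,x_k\in\mathbb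 C\setminus\{0\}$ with $\operatorname{ord}_{x_m}(f_1)\ge j^1_m$ and $\operatorname{ord}_{x_m}(f_2)\ge j^2_m$ for all $m$. When both rows equal $(j_1,\dots,j_k)$, write $N_{j_0}^{j_\infty}(j_1,\dots,j_k)$; indices $j_0=j_\infty=0$ are omitted, and $N_{j_0}^{j_\infty}$ is the case $k=0$. For such a set $N$ and an integer $c$, write $\operatorname{codim}N\ge c$ if every irreducible component of $N$ (in the Zariski topology) has codimension at least $c$ in $\mathbb C^{B_1}\times\mathbb C^{B_2}$; this holds in particular if $N=\varnothing$. Consider the following conditions, where shifts of different sets may be different: 1. $B_1$ and $B_2$ can be shifted to the same sublattice $k\mathbb Z\subset\mathbb Z$ with $k\ge2$. 2. One of the sets, say $B_1$, can be split as $B'\sqcup B''$ so that $B'$, $B''$ and $B_2$ can be shifted to the same sublattice $k\mathbb Z$ with $k\ge3$ (or the same with $B_1$ and $B_2$ exchanged). 3. For each $i=1,2$, the two leftmost elements of $B_i$ differ by more than $1$. 4. For each $i=1,2$, the two rightmost elements of $B_i$ differ by more than $1$. 5. One of the sets, say $B_1$, has exactly two elements, and $\max B_2-\min B_2>2$ (or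 the same with $B_1$ and $B_2$ exchanged). **Theorem.** - $\operatorname{codim}N(1)\ge1$ always. - $\operatorname{codim}N(1,1)\ge2$ unless condition 1 holds. - $\operatorname{codim}N_1^0\ge2$ always. - $\operatorname{codim}N_0^1\ge2$ always. - $\operatorname{codim}N(2)\ge3$ always. - $\operatorname{codim}N(1,1,1)\ge3$ unless at least one of the conditions 1–5 holds. - $\operatorname{codim}N_0^1(1)\ge3$ always. - $\operatorname{codim}N_1^0(1)\ge3$ always. - $\operatorname{codim}N\begin{pmatrix}2,1\\1,1\end{pmatrix}\ge3$ unless condition 1 holds. - $\operatorname{codim}N\begin{pmatrix}1,1\\2,1\end{pmatrix}\ge3$ unless condition 1 holds. -/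

import Mathlib

noncomputable section

namespace SparseResultant

/-! ### Sparse Laurent polynomials and their multiplicities on the projective line -/

/-- The least element of a finite set of integers (the value `0` for the empty set is never used). -/
def lowest (B : Finset ℤ) : ℤ := B.min.untopD 0

/-- The greatest element of a finite set of integers (the value `0` for the empty set is never
used). -/
def highest (B : Finset ℤ) : ℤ := B.max.unbotD 0

/-- The value at `x` (used for `x ≠ 0`) of the Laurent polynomial `∑ f_b x ^ b` supported at `B`. -/
def laurentEval {B : Finset ℤ} (f : B → ℂ) (x : ℂ) : ℂ :=
  ∑ b : B, f b * x ^ (b : ℤ)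

/-- The section `∑ f_b x ^ (b - min B) y ^ (max B - b)` of `𝒪(max B - min B)` on the projective
line, written in the affine chart `y = 1`, which contains `0`. -/
def chartZero {B : Finset ℤ} (f : B → ℂ) : Polynomial ℂ :=
  ∑ b : B, Polynomial.C (f b) * Polynomial.X ^ ((b : ℤ) - lowest B).toNat

/-- The section `∑ f_b x ^ (b - min B) y ^ (max B - b)` of `𝒪(max B - min B)` on the projective
line, written in the affine chart `x = 1`, which contains `∞` (as the point `y = 0`). -/
def chartInfty {B : Finset ℤ} (f : B → ℂ) : Polynomial ℂ :=
  ∑ b : B, Polynomial.C (f b) * Polynomial.X ^ (highest B - (b : ℤ)).toNat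

/-- The multiplicity of the section attached to `f` at a finite point `x` of the projective line,
`x = 0` included. It is `⊤` for `f = 0` and finite otherwise. -/
def ordAt {B : Finset ℤ} (f : B → ℂ) (x : ℂ) : ℕ∞ :=
  emultiplicity (Polynomial.X - Polynomial.C x) (chartZero f)

/-- The multiplicity of the section attached to `f` at the point `∞` of the projective line. -/
def ordInfty {B : Finset ℤ} (f : B → ℂ) : ℕ∞ :=
  emultiplicity Polynomial.X (chartInfty f)

/-- The space `ℂ^{B₁} × ℂ^{B₂}` of pairs of polynomials, as an affine space whose coordinates are
all the coefficients. -/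
abbrev PairSpace (B₁ B₂ : Finset ℤ) : Type := (B₁ ⊕ B₂) → ℂ

/-- The first polynomial of a pair. -/
def PairSpace.fst {B₁ B₂ : Finset ℤ} (F : PairSpace B₁ B₂) : B₁ → ℂ := fun b => F (Sum.inl b)

/-- The second polynomial of a pair. -/
def PairSpace.snd {B₁ B₂ : Finset ℤ} (F : PairSpace B₁ B₂) : B₂ → ℂ := fun b => F (Sum.inr b)

/-- The multiplicity of a pair at a finite point: the minimum of the two multiplicities. -/
def pairOrdAt {B₁ B₂ : Finset ℤ} (F : PairSpace B₁ B₂) (x : ℂ) : ℕ∞ :=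
  min (ordAt F.fst x) (ordAt F.snd x)

/-- The multiplicity of a pair at `∞`: the minimum of the two multiplicities. -/
def pairOrdInfty {B₁ B₂ : Finset ℤ} (F : PairSpace B₁ B₂) : ℕ∞ :=
  min (ordInfty F.fst) (ordInfty F.snd)

/-! ### The filtration subsets -/

/-- The general filtration subset with lower index `j₀`, upper index `jInf` and the two rows of
indices `p` (for the first polynomial) and `q` (for the second one): pairs of non-zero polynomials
whose multiplicities at `0` and `∞` are at least `j₀` and `jInf`, and which have `k` distinct common
roots `x m` in `ℂ^×` of multiplicity at least `p m` for the first and `q m` for the second. -/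
def generalFiltration (B₁ B₂ : Finset ℤ) (j₀ jInf : ℕ) {k : ℕ} (p q : Fin k → ℕ) :
    Set (PairSpace B₁ B₂) :=
  {F | F.fst ≠ 0 ∧ F.snd ≠ 0 ∧
    (j₀ : ℕ∞) ≤ pairOrdAt F 0 ∧ (jInf : ℕ∞) ≤ pairOrdInfty F ∧
    ∃ x : Fin k → ℂ, Function.Injective x ∧ (∀ m, x m ≠ 0) ∧
      (∀ m, laurentEval F.fst (x m) = 0 ∧ laurentEval F.snd (x m) = 0) ∧
      ∀ m, (p m : ℕ∞) ≤ ordAt F.fst (x m) ∧ (q m : ℕ∞) ≤ ordAt F.snd (x m)}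

/-- The symmetric filtration subset with lower index `j₀`, upper index `jInf` and indices `j`: the
multiplicity of the pair at the `m`-th common root is at least `j m`. -/
def symmetricFiltration (B₁ B₂ : Finset ℤ) (j₀ jInf : ℕ) {k : ℕ} (j : Fin k → ℕ) :
    Set (PairSpace B₁ B₂) :=
  {F | F.fst ≠ 0 ∧ F.snd ≠ 0 ∧
    (j₀ : ℕ∞) ≤ pairOrdAt F 0 ∧ (jInf : ℕ∞) ≤ pairOrdInfty F ∧
    ∃ x : Fin k → ℂ, Function.Injective x ∧ (∀ m, x m ≠ 0) ∧
      (∀ m, laurentEval F.fst (x m) = 0 ∧ laurentEval F.snd (x m) = 0) ∧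
      ∀ m, (j m : ℕ∞) ≤ pairOrdAt F (x m)}

/-! ### Codimension -/

/-- The Zariski topology on the affine space `ℂ^σ`. -/
@[reducible] def zariski (σ : Type) : TopologicalSpace (σ → ℂ) :=
  TopologicalSpace.induced (MvPolynomial.pointToPoint (k := ℂ) (K := ℂ)) inferInstance

/-- `Z` is an irreducible component of the subset `N` of affine space, in the Zariski topology:
a maximal irreducible subset of `N`. -/
def IsComponentOf {σ : Type} (Z N : Set (σ → ℂ)) : Prop :=
  Maximal (fun Y : Set (σ → ℂ) => Y ⊆ N ∧ @IsIrreducible (σ → ℂ) (zariski σ) Y) Z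

/-- The codimension of an irreducible subset `Z` of affine space (that is, of its Zariski closure):
the height of the prime ideal of all polynomials vanishing on `Z`. -/
def codim {σ : Type} (Z : Set (σ → ℂ)) : ℕ∞ :=
  (MvPolynomial.vanishingIdeal ℂ Z).height

/-- Every irreducible component of `N` has codimension at least `c` (the empty set qualifies). -/
def CodimAtLeast {σ : Type} (c : ℕ) (N : Set (σ → ℂ)) : Prop :=
  ∀ Z : Set (σ → ℂ), IsComponentOf Z N → (c : ℕ∞) ≤ codim Z

/-! ### The five conditions on the supports -/

/-- `B` can be shifted to the sublattice `kℤ`. -/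
def ShiftsTo (k : ℕ) (B : Finset ℤ) : Prop :=
  ∃ m : ℤ, ∀ b ∈ B, (k : ℤ) ∣ b + m

/-- Both sets can be shifted (each by its own shift) to the same sublattice `kℤ`, `k ≥ 2`. -/
def CondOne (B₁ B₂ : Finset ℤ) : Prop :=
  ∃ k : ℕ, 2 ≤ k ∧ ShiftsTo k B₁ ∧ ShiftsTo k B₂

/-- `A` splits into two parts such that both parts and `B` can be shifted to the same sublattice
`kℤ`, `k ≥ 3`. -/
def SplitsAlong (A B : Finset ℤ) : Prop :=
  ∃ (A' A'' : Finset ℤ) (k : ℕ), Disjoint A' A'' ∧ A' ∪ A'' = A ∧ 3 ≤ k ∧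
    ShiftsTo k A' ∧ ShiftsTo k A'' ∧ ShiftsTo k B

/-- One of the two sets splits along the other. -/
def CondTwo (B₁ B₂ : Finset ℤ) : Prop :=
  SplitsAlong B₁ B₂ ∨ SplitsAlong B₂ B₁

/-- The two leftmost elements of `B` differ by more than `1`. -/
def LeftGap (B : Finset ℤ) : Prop :=
  ∃ a b : ℤ, IsLeast (B : Set ℤ) a ∧ IsLeast ((B : Set ℤ) \ {a}) b ∧ 1 < b - a

/-- The two rightmost elements of `B` differ by more than `1`. -/
def RightGap (B : Finset ℤ) : Prop :=
  ∃ a b : ℤ, IsGreatest (B : Set ℤ) a ∧ IsGreatest ((B : Set ℤ) \ {a}) b ∧ 1 < a - b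

/-- For each of the two sets, the two leftmost elements differ by more than `1`. -/
def CondThree (B₁ B₂ : Finset ℤ) : Prop := LeftGap B₁ ∧ LeftGap B₂

/-- For each of the two sets, the two rightmost elements differ by more than `1`. -/
def CondFour (B₁ B₂ : Finset ℤ) : Prop := RightGap B₁ ∧ RightGap B₂

/-- One of the two sets has exactly `2` elements, and the other one has length more than `2`. -/
def CondFive (B₁ B₂ : Finset ℤ) : Prop :=
  (B₁.card = 2 ∧ 2 < highest B₂ - lowest B₂) ∨ (B₂.card = 2 ∧ 2 < highest B₁ - lowest B₁)

end SparseResultant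

end

/-! Let `Y` be an irreducible subset of one of the sets in question. A generic point of `Y`, taken
on the ring of all functions `Y → ℂ` and not only of polynomials, gives a field `L` where the
coefficients of the pair and its common roots `X j` have images obeying the same identities; the
roots may therefore be chosen pointwise, without any algebraicity. Let `K = ℂ(X j)`. A root, a
double root or a vanishing end coefficient is a `K`-linear relation on the coefficients of one
polynomial; let `W₁`, `W₂` be the spaces of relations. Then `codim Y ≥ dim W₁ + dim W₂ - trdeg K`
(`le_codim_of_relations`), and only ranks and transcendence degrees remain to be compared.

For one root or a boundary condition the count is immediate. For two roots, the monomial rows at `x`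
and `y` are dependent on `B` only if `x / y` is a root of unity killed by all differences of `B`:
the lost rank is repaid by a drop of `trdeg K`, and a loss on both supports at once is condition 1.
With a double root, vanishing confluent minors force `x / y` to be constant, and strict convexity of
the unit circle excludes a simultaneous loss on the other support.

For three roots the hard case is that all 3×3 minors vanish on both supports, where `trdeg K ≤ 1`
and both ranks at least 2 are needed. If a ratio of roots were nonconstant, some valuation trivial
on `ℂ` would separate two roots; leading terms of the minors then force condition 1, 3 or 4, or a
first support of length at most 2, impossible for a nonzero polynomial with three roots
(`conditions_of_valuation_ne`). If the rank on one support is 1, the ratios are roots of unity and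
the other support gives collinear points of the real torus, whence condition 1 or 2 (`torus_line`,
`condOne_or_splitsAlong`). -/

/-! ### Heights, generic points and transcendence degree. -/

theorem Polynomial.height_le_height_map_C {R : Type*} [CommRing R] [IsNoetherianRing R]
    (p : Ideal R) [p.IsPrime] : p.height ≤ (p.map (Polynomial.C : R →+* Polynomial R)).height := by
  have : (p.map (Polynomial.C : R →+* Polynomial R)).LiesOver p := by
    constructor
    ext r
    simp only [Ideal.under_def, Ideal.mem_comap, Polynomial.algebraMap_eq, Ideal.mem_map_C_iff]
    constructor
    · intro h n
      rw [Polynomial.coeff_C]; split_ifs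
      · exact h
      · exact p.zero_mem
    · intro h
      simpa using h 0
  rw [Ideal.height_eq_height_add_of_liesOver_of_hasGoingDown p
    (p.map (Polynomial.C : R →+* Polynomial R))]
  exact le_self_add

open MvPolynomial in
-- This is the inequality "dimension ≤ height + transcendence degree", proved one variable at a
-- time. A new coordinate transcendental over the chosen ones joins `S`; an algebraic one satisfies
-- an equation lying in the kernel but not in the ideal extended from the earlier kernel, so the
-- height grows by one.
theorem exists_algebraicIndependent_card_le_height_add {L : Type} [Field L] [Algebra ℂ L]
    {σ : Type} [Finite σ] (F : σ → L) :
    ∃ S : Set σ, AlgebraicIndepOn ℂ F S ∧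
      (Nat.card σ : ℕ∞) ≤ (RingHom.ker (aeval (R := ℂ) F)).height + Nat.card S := by
  induction σ using Finite.induction_empty_option with
  | @of_equiv α β e H =>
    obtain ⟨S, hS, hc⟩ := H (F ∘ e)
    refine ⟨e '' S, AlgebraicIndependent.image_of_comp S e F hS, ?_⟩
    rw [Nat.card_image_of_injective e.injective, ← Nat.card_congr e]
    refine hc.trans (add_le_add (le_of_eq ?_) le_rfl)
    rw [← RingEquiv.height_comap (renameEquiv ℂ e).toRingEquiv]
    congr 1
    ext p
    simp [RingHom.mem_ker, aeval_rename, Ideal.mem_comap]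
  | h_empty => exact ⟨∅, by simp [AlgebraicIndepOn, algebraicIndependent_empty_type_iff,
      FaithfulSMul.algebraMap_injective], by simp⟩
  | @h_option ι _ H =>
    obtain ⟨S, hS, hc⟩ := H (F ∘ some)
    let f : MvPolynomial ι ℂ →+* L := (aeval (R := ℂ) (F ∘ some)).toRingHom
    let g : Polynomial (MvPolynomial ι ℂ) →+* L := Polynomial.eval₂RingHom f (F none)
    let p : Ideal (MvPolynomial ι ℂ) := RingHom.ker f
    have hp : p.IsPrime := RingHom.ker_isPrime f
    have hle : p.map Polynomial.C ≤ RingHom.ker g := by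
      rw [Ideal.map_le_iff_le_comap]
      intro r hr
      have : f r = 0 := hr
      simp [g, RingHom.mem_ker, this]
    have hker : (RingHom.ker (aeval (R := ℂ) F)).height = (RingHom.ker g).height := by
      rw [← RingEquiv.height_comap (optionEquivLeft ℂ ι).toRingEquiv]
      congr 1
      have : (aeval (R := ℂ) F).toRingHom
          = g.comp ((optionEquivLeft ℂ ι).toRingEquiv : _ →+* _) := by
        apply MvPolynomial.ringHom_ext
        · intro r; simp [g, f]
        · rintro (_ | i) <;> simp [g, f]
      ext q
      exact Eq.congr_left (congrArg (fun h => h q) this)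
    have hS' : AlgebraicIndepOn ℂ F (some '' S) := AlgebraicIndependent.image_of_comp S some F hS
    have hcard : Nat.card (some '' S : Set (Option ι)) = Nat.card S :=
      Nat.card_image_of_injective (Option.some_injective ι) S
    have hpc : p.height ≤ (p.map Polynomial.C).height := Polynomial.height_le_height_map_C p
    have hc' : (Nat.card ι : ℕ∞) ≤ p.height + Nat.card S := hc
    rw [hker, Finite.card_option]
    push_cast
    by_cases halg : Transcendental (Algebra.adjoin ℂ (F '' (some '' S))) (F none)
    · refine ⟨insert none (some '' S), hS'.insert halg, ?_⟩
      have : Nat.card (insert none (some '' S) : Set (Option ι)) = Nat.card S + 1 := by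
        rw [← hcard]
        exact Set.ncard_insert_of_notMem (by simp) (Set.toFinite _)
      rw [this]
      push_cast
      rw [← add_assoc]
      gcongr
      exact hc'.trans (by gcongr; exact hpc.trans (Ideal.height_mono hle))
    · refine ⟨some '' S, hS', ?_⟩
      rw [hcard]
      have hlt : p.map Polynomial.C < RingHom.ker g := by
        refine lt_of_le_of_ne hle fun heq => ?_
        rw [Transcendental, not_not] at halg
        obtain ⟨q, hq0, hq⟩ := halg
        obtain ⟨q', hq'⟩ : ∃ q' : Polynomial (MvPolynomial ι ℂ),
            q'.map f = q.map (algebraMap _ L) := by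
          have : q.map (algebraMap _ L) ∈ Polynomial.lifts f := by
            rw [Polynomial.lifts_iff_coeff_lifts]
            intro n
            rw [Polynomial.coeff_map]
            have h1 : ((q.coeff n : Algebra.adjoin ℂ (F '' (some '' S))) : L) ∈
                Algebra.adjoin ℂ (Set.range (F ∘ some)) :=
              Algebra.adjoin_mono (by rintro _ ⟨_, ⟨i, _, rfl⟩, rfl⟩; exact ⟨i, rfl⟩)
                (q.coeff n).2
            rw [Algebra.adjoin_range_eq_range_aeval] at h1
            exact h1
          exact (Polynomial.mem_lifts _).1 this
        have h2 : q' ∈ RingHom.ker g := by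
          rw [RingHom.mem_ker]
          simp only [g, Polynomial.coe_eval₂RingHom]
          rw [← Polynomial.eval_map, hq', Polynomial.eval_map]
          exact hq
        rw [← heq, Ideal.mem_map_C_iff] at h2
        have h3 : q'.map f = 0 := by
          ext n; rw [Polynomial.coeff_map]; exact h2 n
        rw [hq'] at h3
        exact hq0 (Polynomial.map_injective _ (FaithfulSMul.algebraMap_injective _ _)
          (by rw [h3, Polynomial.map_zero]))
      have hg : (RingHom.ker g).IsPrime := RingHom.ker_isPrime g
      have := Ideal.height_add_one_le_of_lt_of_isPrime hlt
      calc (Nat.card ι : ℕ∞) + 1 ≤ p.height + Nat.card S + 1 := by gcongr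
        _ = p.height + 1 + Nat.card S := by ring
        _ ≤ _ := by
          gcongr
          exact le_trans (by gcongr) this

/-- A generic point of an irreducible set. -/
theorem exists_generic {σ : Type} {Y : Set (σ → ℂ)}
    (hY : @IsIrreducible _ (SparseResultant.zariski σ) Y) :
    ∃ (L : Type) (_ : Field L) (_ : Algebra ℂ L) (φ : (Y → ℂ) →ₐ[ℂ] L),
      ∀ p : MvPolynomial σ ℂ, φ (fun y => MvPolynomial.aeval y.1 p) = 0 ↔
        p ∈ MvPolynomial.vanishingIdeal ℂ Y := by
  classical
  have hprime : ∀ p q : MvPolynomial σ ℂ, p ∉ MvPolynomial.vanishingIdeal ℂ Y →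
      q ∉ MvPolynomial.vanishingIdeal ℂ Y → p * q ∉ MvPolynomial.vanishingIdeal ℂ Y := by
    intro p q hp hq
    have hopen : ∀ p : MvPolynomial σ ℂ,
        @IsOpen _ (SparseResultant.zariski σ) {y : σ → ℂ | MvPolynomial.aeval y p ≠ 0} := by
      intro p
      refine ⟨PrimeSpectrum.basicOpen p, (PrimeSpectrum.basicOpen p).2, ?_⟩
      ext y
      simp [MvPolynomial.pointToPoint, MvPolynomial.mem_vanishingIdeal_iff]
    simp only [MvPolynomial.mem_vanishingIdeal_iff, not_forall] at hp hq ⊢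
    obtain ⟨y, hy, hpy⟩ := hp
    obtain ⟨z, hz, hqz⟩ := hq
    obtain ⟨w, hw, h1, h2⟩ := hY.2 _ _ (hopen p) (hopen q) ⟨y, hy, hpy⟩ ⟨z, hz, hqz⟩
    exact ⟨w, hw, by rw [map_mul]; exact mul_ne_zero h1 h2⟩
  let ev : MvPolynomial σ ℂ →ₐ[ℂ] (Y → ℂ) := MvPolynomial.aeval fun s y => y.1 s
  have hev : ∀ p y, ev p y = MvPolynomial.aeval y.1 p := by
    intro p y
    have : ((Pi.evalAlgHom ℂ (fun _ : Y => ℂ) y).comp ev) = MvPolynomial.aeval y.1 := by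
      ext s; simp [ev]
    exact congrArg (fun g => g p) this
  -- Irreducibility makes the polynomials not vanishing identically on `Y` multiplicatively closed.
  -- A prime of the function ring that avoids them meets the polynomials exactly in the vanishing
  -- ideal.
  let S : Submonoid (Y → ℂ) :=
    { carrier := {g | ∃ p, p ∉ MvPolynomial.vanishingIdeal ℂ Y ∧ g = ev p}
      one_mem' := by
        refine ⟨1, ?_, (map_one _).symm⟩
        obtain ⟨y, hy⟩ := hY.1
        intro h
        simpa using h y hy
      mul_mem' := by
        rintro _ _ ⟨p, hp, rfl⟩ ⟨q, hq, rfl⟩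
        exact ⟨p * q, hprime p q hp hq, (map_mul _ _ _).symm⟩ }
  have hdisj : Disjoint ((⊥ : Ideal (Y → ℂ)) : Set (Y → ℂ)) S := by
    rw [Set.disjoint_left]
    rintro g hg ⟨p, hp, rfl⟩
    apply hp
    intro y hy
    rw [← hev p ⟨y, hy⟩]
    have : ev p = 0 := hg
    rw [this]; rfl
  obtain ⟨P, hP, -, hPS⟩ := Ideal.exists_le_prime_disjoint ⊥ S hdisj
  let φ : (Y → ℂ) →ₐ[ℂ] FractionRing ((Y → ℂ) ⧸ P) :=
    (Algebra.algHom ℂ ((Y → ℂ) ⧸ P) (FractionRing ((Y → ℂ) ⧸ P))).comp (Ideal.Quotient.mkₐ ℂ P)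
  refine ⟨FractionRing ((Y → ℂ) ⧸ P), inferInstance, inferInstance, φ, fun p => ?_⟩
  have hp0 : (fun y : Y => MvPolynomial.aeval y.1 p) = ev p := by ext y; rw [hev]
  rw [hp0]
  have hφ : ∀ g, φ g = 0 ↔ g ∈ P := by
    intro g
    have : φ g = algebraMap _ _ (Ideal.Quotient.mk P g) := rfl
    rw [this, FaithfulSMul.algebraMap_eq_zero_iff, Ideal.Quotient.eq_zero_iff_mem]
  rw [hφ]
  constructor
  · intro h
    by_contra hp
    exact Set.disjoint_left.1 hPS h ⟨p, hp, rfl⟩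
  · intro h
    have : ev p = 0 := by
      ext y; rw [hev]; exact h y.1 y.2
    rw [this]; exact P.zero_mem

/-- Independent linear relations over a field of small transcendence degree force height. -/
theorem finrank_le_height_add {L : Type} [Field L] [Algebra ℂ L] {σ : Type} [Fintype σ]
    (F : σ → L) (K : IntermediateField ℂ L) (W : Submodule K (σ → K))
    (hW : ∀ w ∈ W, ∑ s, (w s : L) * F s = 0) (t : ℕ) (ht : Algebra.trdeg ℂ K ≤ t) :
    (Module.finrank K W : ℕ∞) ≤ (RingHom.ker (MvPolynomial.aeval (R := ℂ) F)).height + t := by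
  obtain ⟨S, hS, hcard⟩ := exists_algebraicIndependent_card_le_height_add F
  let ψ : (σ → K) →ₗ[K] L := Fintype.linearCombination K F
  have hψ : ∀ w, ψ w = ∑ s, (w s : L) * F s := fun w => by
    simp [ψ, Fintype.linearCombination_apply, Algebra.smul_def]
  have hWk : Module.finrank K W ≤ Module.finrank K (LinearMap.ker ψ) :=
    Submodule.finrank_mono fun w hw => by rw [LinearMap.mem_ker, hψ]; exact hW w hw
  have hrn := LinearMap.finrank_range_add_finrank_ker ψ
  rw [Module.finrank_fintype_fun_eq_card] at hrn
  have hfree : Module.Free K (LinearMap.range ψ) := Module.Free.of_divisionRing K _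
  have hfin : Module.Finite K (LinearMap.range ψ) := inferInstance
  let b : Module.Basis _ K (LinearMap.range ψ) := Module.finBasis K (LinearMap.range ψ)
  let T : Set L := Set.range fun i => (b i : L)
  -- The `F s` are `K`-combinations of a basis of their span, whose size is the number of
  -- coordinates minus the dimension of all relations. This bounds the transcendence degree of `A`
  -- over `K`, hence the independent set `S`.
  let A := Algebra.adjoin K T
  have hFA : ∀ s, F s ∈ A := by
    intro s
    have h1 : F s ∈ LinearMap.range ψ := by
      classical
      refine ⟨Pi.single s 1, ?_⟩
      rw [hψ, Finset.sum_eq_single s] <;> simp +contextual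
    have h2 := b.sum_repr ⟨F s, h1⟩
    have h3 := congrArg (Subtype.val) h2
    replace h3 : F s = _ := h3.symm
    rw [h3]
    push_cast
    refine sum_mem fun i _ => ?_
    have hbi : (b i : L) ∈ A := Algebra.subset_adjoin (Set.mem_range_self i)
    exact A.smul_mem hbi _
  have hAdeg : Algebra.trdeg K A ≤ (Module.finrank K (LinearMap.range ψ) : ℕ) := by
    let T' : Set A := Set.range fun i => (⟨(b i : L), Algebra.subset_adjoin (Set.mem_range_self i)⟩ : A)
    have htop : Algebra.adjoin K T' = ⊤ := by
      have h := Algebra.adjoin_adjoin_coe_preimage (R := K) (s := T)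
      convert h using 2
      ext a
      simp only [T', T, Set.mem_range, Set.mem_preimage]
      constructor
      · rintro ⟨i, rfl⟩; exact ⟨i, rfl⟩
      · rintro ⟨i, hi⟩; exact ⟨i, Subtype.ext hi⟩
    have : Algebra.IsAlgebraic (Algebra.adjoin K T') A := by
      constructor
      intro a
      have ha : a ∈ Algebra.adjoin K T' := by rw [htop]; trivial
      exact isAlgebraic_algebraMap (⟨a, ha⟩ : Algebra.adjoin K T')
    refine (Algebra.IsAlgebraic.trdeg_le_cardinalMk K T').trans (Cardinal.mk_range_le.trans ?_)
    simp
  have hfaith : FaithfulSMul K A :=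
    (faithfulSMul_iff_algebraMap_injective K A).2 (algebraMap K A).injective
  have hsum : Algebra.trdeg ℂ K + Algebra.trdeg K A = Algebra.trdeg ℂ A := trdeg_add_eq ℂ K
  have hS' : AlgebraicIndependent ℂ (fun s : S => (⟨F s, hFA s⟩ : A)) := by
    refine AlgebraicIndependent.of_comp (A.val.restrictScalars ℂ) ?_
    exact hS
  have hSc : (Nat.card S) ≤ t + Module.finrank K (LinearMap.range ψ) := by
    have h := hS'.cardinalMk_le_trdeg
    rw [← hsum] at h
    have h2 := h.trans (add_le_add ht hAdeg)
    rw [← Nat.cast_add, ← Nat.cast_card] at h2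
    exact_mod_cast h2
  rw [Nat.card_eq_fintype_card] at hcard
  generalize (RingHom.ker (MvPolynomial.aeval (R := ℂ) F)).height = H at *
  induction H using ENat.recTopCoe with
  | top => simp
  | coe H => norm_cast at *; omega

/-! ### Codimension from linear relations over the field of roots. -/

namespace SparseResultant

theorem le_finrank_of_det_ne_zero {K ι : Type*} [Field K] [Fintype ι] {n : ℕ}
    (W : Submodule K (ι → K)) (p : Fin n → ι → K) (hp : ∀ i, p i ∈ W) (idx : Fin n → ι)
    (hdet : (Matrix.of fun i j => p i (idx j)).det ≠ 0) : n ≤ Module.finrank K W := by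
  have h1 : LinearIndependent K (Matrix.of fun i j => p i (idx j)).row :=
    Matrix.linearIndependent_rows_of_det_ne_zero hdet
  have h2 : LinearIndependent K p := LinearIndependent.of_comp (LinearMap.funLeft K K idx) h1
  have h3 : LinearIndependent K (fun i => (⟨p i, hp i⟩ : W)) :=
    LinearIndependent.of_comp W.subtype h2
  simpa using h3.fintype_card_le_finrank

theorem trdeg_le_of_adjoin_eq_top {K : Type} [Field K] [Algebra ℂ K] {k : ℕ} (x : Fin k → K)
    (hx : IntermediateField.adjoin ℂ (Set.range x) = ⊤) : Algebra.trdeg ℂ K ≤ k := by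
  have h1 : Algebra.IsAlgebraic (IntermediateField.adjoin ℂ (Set.range x)) K := by
    rw [hx]
    exact ⟨fun a => isAlgebraic_algebraMap (⟨a, trivial⟩ : (⊤ : IntermediateField ℂ K))⟩
  have h2 := IntermediateField.isAlgebraic_adjoin_iff_top.1 h1
  refine (Algebra.IsAlgebraic.trdeg_le_cardinalMk ℂ (Set.range x)).trans
    (Cardinal.mk_range_le.trans ?_)
  simp

theorem trdeg_le_of_not_algebraicIndependent {K : Type} [Field K] [Algebra ℂ K] {k : ℕ}
    (x : Fin (k + 1) → K) (hx : IntermediateField.adjoin ℂ (Set.range x) = ⊤)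
    (hind : ¬ AlgebraicIndependent ℂ x) : Algebra.trdeg ℂ K ≤ k := by
  have h0 := trdeg_le_of_adjoin_eq_top x hx
  have h1 : Algebra.IsAlgebraic (IntermediateField.adjoin ℂ (Set.range x)) K := by
    rw [hx]
    exact ⟨fun a => isAlgebraic_algebraMap (⟨a, trivial⟩ : (⊤ : IntermediateField ℂ K))⟩
  have h2 := IntermediateField.isAlgebraic_adjoin_iff_top.1 h1
  by_contra hlt
  obtain ⟨n, hn⟩ := Cardinal.lt_aleph0.1 (h0.trans_lt (Cardinal.natCast_lt_aleph0))
  rw [hn] at hlt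
  have hn' : k + 1 ≤ n := by
    by_contra h
    exact hlt (by exact_mod_cast (by omega : n ≤ k))
  apply hind
  refine (Algebra.IsAlgebraic.isTranscendenceBasis_of_le_trdeg_of_finite ℂ x ?_).1
  rw [hn]
  simpa using (show ((k + 1 : ℕ) : Cardinal.{0}) ≤ n by exact_mod_cast hn')

variable {B₁ B₂ : Finset ℤ}

/-- The two spaces of relations involve disjoint sets of coordinates, so their dimensions add. -/
theorem le_codim_of_relations {Y : Set (PairSpace B₁ B₂)} {L : Type} [Field L] [Algebra ℂ L]
    (φ : (Y → ℂ) →ₐ[ℂ] L)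
    (hφ : ∀ p : MvPolynomial (B₁ ⊕ B₂) ℂ, φ (fun y => MvPolynomial.aeval y.1 p) = 0 ↔
        p ∈ MvPolynomial.vanishingIdeal ℂ Y)
    (K : IntermediateField ℂ L) (W₁ : Submodule K (B₁ → K)) (W₂ : Submodule K (B₂ → K))
    (h₁ : ∀ w ∈ W₁, ∑ b, (w b : L) * φ (fun y => y.1 (Sum.inl b)) = 0)
    (h₂ : ∀ w ∈ W₂, ∑ b, (w b : L) * φ (fun y => y.1 (Sum.inr b)) = 0)
    {r₁ r₂ t c : ℕ} (hr₁ : r₁ ≤ Module.finrank K W₁) (hr₂ : r₂ ≤ Module.finrank K W₂)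
    (ht : Algebra.trdeg ℂ K ≤ t) (hc : c + t ≤ r₁ + r₂) : (c : ℕ∞) ≤ codim Y := by
  let F : B₁ ⊕ B₂ → L := fun s => φ (fun y => y.1 s)
  let e := LinearEquiv.sumArrowLequivProdArrow B₁ B₂ K K
  let W : Submodule K (B₁ ⊕ B₂ → K) :=
    (W₁.prod W₂).map
      (e.symm : (B₁ → K) × (B₂ → K) →ₗ[K] (B₁ ⊕ B₂ → K))
  have hW : ∀ w ∈ W, ∑ s, (w s : L) * F s = 0 := by
    rintro _ ⟨⟨v₁, v₂⟩, ⟨hv₁, hv₂⟩, rfl⟩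
    rw [Fintype.sum_sum_type]
    have e1 := h₁ v₁ hv₁
    have e2 := h₂ v₂ hv₂
    simpa [e, F] using congrArg₂ (· + ·) e1 e2
  have hfin : Module.finrank K W = Module.finrank K W₁ + Module.finrank K W₂ := by
    rw [LinearEquiv.finrank_map_eq, ← Module.finrank_prod]
    exact LinearEquiv.finrank_eq
      { toFun := fun v => (⟨v.1.1, v.2.1⟩, ⟨v.1.2, v.2.2⟩)
        invFun := fun v => ⟨(v.1.1, v.2.1), ⟨v.1.2, v.2.2⟩⟩
        map_add' := fun _ _ => rfl
        map_smul' := fun _ _ => rfl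
        left_inv := fun _ => rfl
        right_inv := fun _ => rfl }
  have hker : RingHom.ker (MvPolynomial.aeval (R := ℂ) F) = MvPolynomial.vanishingIdeal ℂ Y := by
    ext p
    rw [← hφ, RingHom.mem_ker]
    have h : (MvPolynomial.aeval (R := ℂ) F) =
        φ.comp (MvPolynomial.aeval (fun s (y : Y) => y.1 s)) := by
      ext s; simp [F]
    have h' : ∀ y : Y, MvPolynomial.aeval (fun s (y : Y) => y.1 s) p y
        = MvPolynomial.aeval y.1 p := by
      intro y
      have : ((Pi.evalAlgHom ℂ (fun _ : Y => ℂ) y).comp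
          (MvPolynomial.aeval (fun s (y : Y) => y.1 s))) = MvPolynomial.aeval y.1 := by
        ext s; simp
      exact congrArg (fun g => g p) this
    rw [h, AlgHom.comp_apply]
    rw [show MvPolynomial.aeval (fun s (y : Y) => y.1 s) p =
      fun y : Y => MvPolynomial.aeval y.1 p from funext h']
  have key := finrank_le_height_add F K W hW t ht
  rw [hker, hfin] at key
  unfold codim
  generalize (MvPolynomial.vanishingIdeal ℂ Y).height = H at *
  induction H using ENat.recTopCoe with
  | top => simp
  | coe H => norm_cast at *; omega

theorem map_zpow_of_ne_zero {Y L : Type} [Field L] [Algebra ℂ L] (φ : (Y → ℂ) →ₐ[ℂ] L)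
    (g : Y → ℂ) (hg : ∀ y, g y ≠ 0) (b : ℤ) : φ (fun y => g y ^ b) = φ g ^ b := by
  let u : (Y → ℂ)ˣ := ⟨g, fun y => (g y)⁻¹, by ext y; simp [hg], by ext y; simp [hg]⟩
  have h1 : (fun y => g y ^ b) = ((u ^ b : (Y → ℂ)ˣ) : Y → ℂ) := by
    ext y
    have := map_zpow (Units.map (Pi.evalMonoidHom (fun _ : Y => ℂ) y)) u b
    have h2 := congrArg Units.val this
    rw [Units.val_zpow_eq_zpow_val] at h2
    exact h2.symm
  rw [h1]
  have := congrArg Units.val (map_zpow (Units.map (φ : (Y → ℂ) →* L)) u b)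
  rw [Units.val_zpow_eq_zpow_val] at this
  exact this

/-- Nowhere vanishing functions are units, so the images of the roots and of their differences are
nonzero. This is how nonzero and distinct roots survive at the generic point. -/
theorem exists_generic_pair {Y : Set (PairSpace B₁ B₂)}
    (hY : @IsIrreducible _ (zariski (B₁ ⊕ B₂)) Y)
    (h₁ : ∀ F ∈ Y, F.fst ≠ 0) (h₂ : ∀ F ∈ Y, F.snd ≠ 0) {k : ℕ} (x : Y → Fin k → ℂ)
    (hx0 : ∀ y j, x y j ≠ 0) (hx : ∀ y, Function.Injective (x y)) :
    ∃ (L : Type) (_ : Field L) (_ : Algebra ℂ L) (φ : (Y → ℂ) →ₐ[ℂ] L)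
      (K : IntermediateField ℂ L) (X : Fin k → K),
      (∀ p : MvPolynomial (B₁ ⊕ B₂) ℂ, φ (fun y => MvPolynomial.aeval y.1 p) = 0 ↔
        p ∈ MvPolynomial.vanishingIdeal ℂ Y) ∧
      (∃ b, φ (fun y => y.1 (Sum.inl b)) ≠ 0) ∧ (∃ b, φ (fun y => y.1 (Sum.inr b)) ≠ 0) ∧
      (∀ j, X j ≠ 0) ∧ Function.Injective X ∧
      IntermediateField.adjoin ℂ (Set.range X) = ⊤ ∧
      ∀ j (b : ℤ), φ (fun y => x y j ^ b) = (X j : L) ^ b := by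
  obtain ⟨L, _, _, φ, hφ⟩ := exists_generic hY
  have hunit : ∀ g : Y → ℂ, (∀ y, g y ≠ 0) → φ g ≠ 0 := by
    intro g hg h
    have : φ (g * fun y => (g y)⁻¹) = 0 := by rw [map_mul, h, zero_mul]
    rw [show (g * fun y => (g y)⁻¹) = 1 by ext y; simp [hg], map_one] at this
    exact one_ne_zero this
  let S : Set L := Set.range fun j => φ fun y => x y j
  let K := IntermediateField.adjoin ℂ S
  let X : Fin k → K := fun j => ⟨φ fun y => x y j,
    IntermediateField.subset_adjoin ℂ S (Set.mem_range_self j)⟩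
  refine ⟨L, _, _, φ, K, X, hφ, ?_, ?_, ?_, ?_, ?_, ?_⟩
  · by_contra! h
    obtain ⟨y, hy⟩ := hY.1
    apply h₁ y hy
    ext b
    have := (hφ (MvPolynomial.X (Sum.inl b))).1 (by simpa using h b)
    simpa [PairSpace.fst, MvPolynomial.mem_vanishingIdeal_iff] using this y hy
  · by_contra! h
    obtain ⟨y, hy⟩ := hY.1
    apply h₂ y hy
    ext b
    have := (hφ (MvPolynomial.X (Sum.inr b))).1 (by simpa using h b)
    simpa [PairSpace.snd, MvPolynomial.mem_vanishingIdeal_iff] using this y hy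
  · intro j h
    exact hunit _ (fun y => hx0 y j) (congrArg Subtype.val h)
  · intro i j h
    by_contra hij
    refine hunit ((fun y => x y i) - fun y => x y j) (fun y h0 => ?_) ?_
    · exact hij (hx y (sub_eq_zero.1 h0))
    · rw [map_sub, sub_eq_zero]
      exact congrArg Subtype.val h
  · apply IntermediateField.map_injective K.val
    rw [IntermediateField.adjoin_map, ← Set.range_comp]
    rw [← AlgHom.fieldRange_eq_map, IntermediateField.fieldRange_val]
    rfl
  · intro j b
    exact map_zpow_of_ne_zero φ _ (fun y => hx0 y j) b

/-! ### Minors of three rows of monomials -/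

section Minors

variable {K : Type} [Field K]

/-- The minor with columns `a, b, c` of the matrix with rows `x ^ n`, `y ^ n`, `z ^ n`. -/
def monomialMinor (x y z : K) (a b c : ℤ) : K :=
  x ^ a * (y ^ b * z ^ c - y ^ c * z ^ b) - x ^ b * (y ^ a * z ^ c - y ^ c * z ^ a) +
    x ^ c * (y ^ a * z ^ b - y ^ b * z ^ a)

/-- All minors with columns in `B` vanish. -/
def MinorsVanish (B : Finset ℤ) (x y z : K) : Prop :=
  ∀ a ∈ B, ∀ b ∈ B, ∀ c ∈ B, monomialMinor x y z a b c = 0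

theorem MinorsVanish.swap_left {B : Finset ℤ} {x y z : K} (h : MinorsVanish B x y z) :
    MinorsVanish B y x z := by
  intro a ha b hb c hc
  have := h a ha b hb c hc
  unfold monomialMinor at *
  linear_combination -this

theorem MinorsVanish.swap_right {B : Finset ℤ} {x y z : K} (h : MinorsVanish B x y z) :
    MinorsVanish B x z y := by
  intro a ha b hb c hc
  have := h a ha b hb c hc
  unfold monomialMinor at *
  linear_combination -this

theorem MinorsVanish.inv {B : Finset ℤ} {x y z : K} (h : MinorsVanish B x y z) :
    MinorsVanish (B.image Neg.neg) x⁻¹ y⁻¹ z⁻¹ := by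
  intro a ha b hb c hc
  obtain ⟨a', ha', rfl⟩ := Finset.mem_image.1 ha
  obtain ⟨b', hb', rfl⟩ := Finset.mem_image.1 hb
  obtain ⟨c', hc', rfl⟩ := Finset.mem_image.1 hc
  have := h a' ha' b' hb' c' hc'
  unfold monomialMinor at *
  simpa using this

/-- Dividing each row by its entry in column `m` and the bases by `y` leaves a relation between the
two ratios `x / y` and `z / y` alone. With `m` the least exponent, all powers in it are nonnegative.
-/
theorem MinorsVanish.normalized {B : Finset ℤ} {x y z : K} (h : MinorsVanish B x y z)
    (hx : x ≠ 0) (hy : y ≠ 0) (hz : z ≠ 0) {m a b : ℤ} (hm : m ∈ B) (ha : a ∈ B) (hb : b ∈ B) :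
    (x / y) ^ (a - m) - (x / y) ^ (b - m) = (z / y) ^ (a - m) * (1 - (x / y) ^ (b - m)) -
      (z / y) ^ (b - m) * (1 - (x / y) ^ (a - m)) := by
  have := h m hm a ha b hb
  unfold monomialMinor at this
  have hxm := zpow_ne_zero m hx
  have hym := zpow_ne_zero m hy
  have hzm := zpow_ne_zero m hz
  have hya := zpow_ne_zero a hy
  have hyb := zpow_ne_zero b hy
  simp only [div_zpow, zpow_sub₀ hx, zpow_sub₀ hy, zpow_sub₀ hz]
  field_simp
  linear_combination this

end Minors

/-! ### Valuations trivial on the constants -/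

section Valuation

theorem zpow_natAbs_eq_one {K : Type} [Field K] {u : K} {n : ℤ} (hu : u ^ n = 1) :
    u ^ n.natAbs = 1 := by
  rcases Int.natAbs_eq n with h | h
  · rw [← zpow_natCast, ← h, hu]
  · rw [h, zpow_neg, inv_eq_one, zpow_natCast] at hu
    exact hu

variable {K : Type} [Field K] [Algebra ℂ K]

theorem mem_range_algebraMap_of_isAlgebraic {u : K} (hu : IsAlgebraic ℂ u) :
    ∃ c : ℂ, algebraMap ℂ K c = u := by
  have hint := hu.isIntegral
  have h1 := IsAlgClosed.degree_eq_one_of_irreducible ℂ (minpoly.irreducible hint)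
  exact minpoly.mem_range_of_degree_eq_one ℂ u h1

theorem mem_range_algebraMap_of_zpow_eq_one {u : K} {n : ℤ} (hn : n ≠ 0) (hu : u ^ n = 1) :
    ∃ c : ℂ, algebraMap ℂ K c = u := by
  apply mem_range_algebraMap_of_isAlgebraic
  have h1 := zpow_natAbs_eq_one hu
  refine ⟨Polynomial.X ^ n.natAbs - 1, ?_, by simp [h1]⟩
  exact Polynomial.X_pow_sub_C_ne_zero (Int.natAbs_pos.2 hn) (1 : ℂ)

/-- A nonconstant `u` is transcendental, hence not a unit of `ℂ[u]`, and a valuation ring containing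
`ℂ[u]` can be found with `u` in its maximal ideal. -/
theorem exists_valuation_lt_one {u : K} (hu : ¬ ∃ c : ℂ, algebraMap ℂ K c = u) :
    ∃ A : ValuationSubring K, (∀ c : ℂ, c ≠ 0 → A.valuation (algebraMap ℂ K c) = 1) ∧
      A.valuation u < 1 := by
  have htr : Transcendental ℂ u := fun h => hu (mem_range_algebraMap_of_isAlgebraic h)
  let R : Subalgebra ℂ K := Algebra.adjoin ℂ {u}
  let u' : R.toSubring := ⟨u, Algebra.subset_adjoin rfl⟩
  have hI : Ideal.span {u'} ≠ ⊤ := by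
    rw [Ne, Ideal.span_singleton_eq_top]
    rintro h
    obtain ⟨⟨w, hw⟩, hw1⟩ := h.exists_right_inv
    replace hw : w ∈ Algebra.adjoin ℂ {u} := hw
    rw [Algebra.adjoin_singleton_eq_range_aeval] at hw
    obtain ⟨p, rfl⟩ := hw
    have h2 : Polynomial.aeval u (Polynomial.X * p - 1) = 0 := by
      have := congrArg Subtype.val hw1
      simp only [map_sub, map_mul, Polynomial.aeval_X, map_one, sub_eq_zero]
      exact this
    have h3 := (transcendental_iff.1 htr) _ h2
    have := congrArg (Polynomial.eval 0) h3
    simp at this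
  obtain ⟨A, hRA, hAI⟩ := Ideal.image_subset_nonunits_valuationSubring _ hI
  refine ⟨A, fun c hc => ?_, ?_⟩
  · have hmem : ∀ d : ℂ, A.valuation (algebraMap ℂ K d) ≤ 1 := fun d =>
      (A.valuation_le_one_iff _).2 (hRA (R.algebraMap_mem d))
    refine le_antisymm (hmem c) ?_
    have := hmem c⁻¹
    rw [map_inv₀, map_inv₀] at this
    have hne : A.valuation (algebraMap ℂ K c) ≠ 0 := by simpa using hc
    rwa [inv_le_one₀ (zero_lt_iff.2 hne)] at this
  · have : u ∈ A.nonunits := hAI ⟨u', Ideal.mem_span_singleton_self _, rfl⟩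
    exact this

variable {Γ : Type} [LinearOrderedCommGroupWithZero Γ] (v : Valuation K Γ)

theorem exists_root_of_unity_near
    {u : K} {d : ℤ} (hd : 0 < d) (hu : v (u ^ d - 1) < 1) :
    ∃ ζ : ℂ, ζ ^ d = 1 ∧ ζ ≠ 0 ∧ v (u - algebraMap ℂ K ζ) < 1 := by
  lift d to ℕ using hd.le
  norm_cast at hd
  simp only [zpow_natCast] at *
  have hprod : u ^ d - 1 = ∏ ζ ∈ Polynomial.nthRootsFinset d (1 : ℂ), (u - algebraMap ℂ K ζ) := by
    have h := congrArg (Polynomial.aeval u)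
      (Polynomial.X_pow_sub_one_eq_prod hd (Complex.isPrimitiveRoot_exp d hd.ne'))
    simpa using h
  rw [hprod, map_prod] at hu
  by_contra! hcon
  refine absurd hu (not_lt.2 (Finset.one_le_prod' fun ζ hζ => ?_))
  have h1 : ζ ^ d = 1 := (Polynomial.mem_nthRootsFinset hd (1 : ℂ)).1 hζ
  exact hcon ζ h1 (by rintro rfl; simp [hd.ne'] at h1)

/-- The first-order expansion `w ^ n = 1 + n (w - 1) + O((w - 1) ^ 2)`, valid for negative `n` too.
-/
theorem valuation_zpow_sub_linear_le (hv : ∀ c : ℂ, c ≠ 0 → v (algebraMap ℂ K c) = 1)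
    {w : K} (hw : v (w - 1) < 1) (n : ℤ) :
    v (w ^ n - 1 - n * (w - 1)) ≤ v (w - 1) ^ 2 := by
  have hint : ∀ m : ℤ, v (m : K) ≤ 1 := by
    intro m
    rcases eq_or_ne (m : ℂ) 0 with h | h
    · have : (m : K) = algebraMap ℂ K m := by simp
      rw [this, h]; simp
    · have := hv m h
      simpa using this.le
  have hw1 : v w = 1 := by
    have h := v.map_add_eq_of_lt_right (x := w - 1) (y := 1) (by simpa using hw)
    simpa using h
  have hw0 : w ≠ 0 := by rintro rfl; simp at hw1
  have hsq : ∀ m : ℤ, v (m * (w - 1) ^ 2) ≤ v (w - 1) ^ 2 := by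
    intro m
    rw [map_mul, map_pow]
    exact mul_le_of_le_one_left' (hint m)
  induction n using Int.induction_on with
  | zero => simp
  | succ n ih =>
    have h : w ^ ((n : ℤ) + 1) - 1 - (((n : ℤ) + 1 : ℤ) : K) * (w - 1) =
        w * (w ^ (n : ℤ) - 1 - ((n : ℤ) : K) * (w - 1)) + ((n : ℤ) : K) * (w - 1) ^ 2 := by
      rw [zpow_add_one₀ hw0]; push_cast; ring
    rw [h]
    refine v.map_add_le ?_ (hsq n)
    rw [map_mul, hw1, one_mul]; exact ih
  | pred n ih =>
    have h : w ^ (-(n : ℤ) - 1) - 1 - ((-(n : ℤ) - 1 : ℤ) : K) * (w - 1) =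
        w⁻¹ * ((w ^ (-(n : ℤ)) - 1 - ((-(n : ℤ) : ℤ) : K) * (w - 1)) -
          ((-(n : ℤ) - 1 : ℤ) : K) * (w - 1) ^ 2) := by
      rw [zpow_sub_one₀ hw0]
      generalize w ^ (-(n : ℤ)) = W
      push_cast
      field_simp
      ring
    rw [h, map_mul, map_inv₀, hw1, inv_one, one_mul]
    exact v.map_sub_le ih (hsq _)

end Valuation

section Valuation

variable {K : Type} [Field K]
variable {Γ : Type} [LinearOrderedCommGroupWithZero Γ] (v : Valuation K Γ)

theorem valuation_zpow_lt_zpow {y : K} (hy0 : y ≠ 0) (hy : v y < 1) {a b : ℤ} (hab : a < b) :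
    v (y ^ b) < v (y ^ a) := by
  rw [map_zpow₀, map_zpow₀]
  exact zpow_lt_zpow_right_of_lt_one₀ (zero_lt_iff.2 (by simpa using hy0)) hy hab

/-- In the residue field `y` becomes 0, and the relation reduces to `u ^ a = u ^ b`. -/
theorem valuation_zpow_sub_one_lt {u y : K} (hu1 : v u = 1) (hy0 : y ≠ 0) (hy : v y < 1)
    {a b : ℤ} (ha : 0 < a) (hab : a < b)
    (E : u ^ a - u ^ b = y ^ a * (1 - u ^ b) - y ^ b * (1 - u ^ a)) : v (u ^ (b - a) - 1) < 1 := by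
  have hu0 : u ≠ 0 := by rintro rfl; simp at hu1
  have hpow : ∀ n : ℤ, v (u ^ n) = 1 := fun n => by rw [map_zpow₀, hu1, one_zpow]
  have hle : ∀ n : ℤ, v (1 - u ^ n) ≤ 1 := fun n => v.map_sub_le (by simp) (hpow n).le
  have hylt : ∀ n : ℤ, 0 < n → v (y ^ n) < 1 := fun n hn => by
    simpa using valuation_zpow_lt_zpow v hy0 hy hn
  have h1 : v (u ^ a - u ^ b) = v (u ^ (b - a) - 1) := by
    rw [v.map_sub_swap]
    have : u ^ b - u ^ a = u ^ a * (u ^ (b - a) - 1) := by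
      rw [mul_sub, ← zpow_add₀ hu0]; simp
    rw [this, map_mul, hpow, one_mul]
  rw [← h1, E]
  apply v.map_sub_lt
  · rw [map_mul]; exact mul_lt_one_of_lt_of_le (hylt a ha) (hle b)
  · rw [map_mul]; exact mul_lt_one_of_lt_of_le (hylt b (ha.trans hab)) (hle a)

variable [Algebra ℂ K]

theorem constant_eq_one_of_valuation (hv : ∀ c : ℂ, c ≠ 0 → v (algebraMap ℂ K c) = 1) {c : ℂ}
    (hc : v (algebraMap ℂ K c - 1) < 1) : c = 1 := by
  by_contra h
  have := hv (c - 1) (sub_ne_zero.2 h)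
  rw [map_sub, map_one] at this
  exact absurd hc (by rw [this]; exact lt_irrefl _)

theorem zpow_eq_one_of_constant (hv : ∀ c : ℂ, c ≠ 0 → v (algebraMap ℂ K c) = 1) {ζ : ℂ}
    (hζ : ζ ≠ 0) {y : K} (hy0 : y ≠ 0) (hy : v y < 1) {a b : ℤ} (ha : 0 < a) (hab : a < b)
    (E : algebraMap ℂ K ζ ^ a - algebraMap ℂ K ζ ^ b =
      y ^ a * (1 - algebraMap ℂ K ζ ^ b) - y ^ b * (1 - algebraMap ℂ K ζ ^ a)) :
    ζ ^ a = 1 ∧ ζ ^ b = 1 := by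
  have h1 := valuation_zpow_sub_one_lt v (hv ζ hζ) hy0 hy ha hab E
  rw [← map_zpow₀] at h1
  have h2 := constant_eq_one_of_valuation v hv h1
  have h3 : ζ ^ b = ζ ^ a := by
    rw [zpow_sub₀ hζ, div_eq_one_iff_eq (zpow_ne_zero a hζ)] at h2
    exact h2
  have h4 : ζ ^ a = 1 := by
    rw [← map_zpow₀, ← map_zpow₀, h3] at E
    have h5 : (y ^ a - y ^ b) * (1 - algebraMap ℂ K (ζ ^ a)) = 0 := by linear_combination -E
    rcases mul_eq_zero.1 h5 with h | h
    · have := valuation_zpow_lt_zpow v hy0 hy hab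
      rw [sub_eq_zero.1 h] at this
      exact absurd this (lt_irrefl _)
    · apply FaithfulSMul.algebraMap_injective ℂ K
      rw [map_one]; exact (sub_eq_zero.1 h).symm
  exact ⟨h4, h3.trans h4⟩

/-- Write `u = ζ w` and expand in `w - 1`. The left side starts with `ζ ^ a (a - b) (w - 1)`, the
right side with `y ^ a (1 - ζ ^ a)`. Here `ζ ^ a ≠ 1`, since otherwise the right side would be
smaller than `w - 1`; so the two leading terms must match. -/
theorem leading_terms (hv : ∀ c : ℂ, c ≠ 0 → v (algebraMap ℂ K c) = 1) {ζ : ℂ}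
    (hζ : ζ ≠ 0) {u y : K} (hu : v (u - algebraMap ℂ K ζ) < 1) (hne : u ≠ algebraMap ℂ K ζ)
    (hy0 : y ≠ 0) (hy : v y < 1) {a b : ℤ} (ha : 0 < a) (hab : a < b)
    (E : u ^ a - u ^ b = y ^ a * (1 - u ^ b) - y ^ b * (1 - u ^ a)) :
    ζ ^ b = ζ ^ a ∧ v (u / algebraMap ℂ K ζ - 1) = v y ^ a ∧
      v (algebraMap ℂ K (ζ ^ a * (a - b)) * (u / algebraMap ℂ K ζ - 1) -
        y ^ a * algebraMap ℂ K (1 - ζ ^ a)) < v (u / algebraMap ℂ K ζ - 1) := by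
  have hz0 : algebraMap ℂ K ζ ≠ 0 := by simpa using hζ
  have hu1 : v u = 1 := by
    rw [← hv ζ hζ]
    have h := v.map_add_eq_of_lt_right (x := u - algebraMap ℂ K ζ) (y := algebraMap ℂ K ζ)
      (by rwa [hv ζ hζ])
    simpa using h
  have hpow : ∀ n : ℤ, v (u ^ n) = 1 := fun n => by rw [map_zpow₀, hu1, one_zpow]
  obtain ⟨w, rfl⟩ : ∃ w, u = algebraMap ℂ K ζ * w := ⟨u / algebraMap ℂ K ζ, by field_simp⟩
  have hw : v (w - 1) < 1 := by
    have : algebraMap ℂ K ζ * w - algebraMap ℂ K ζ = algebraMap ℂ K ζ * (w - 1) := by ring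
    rwa [this, map_mul, hv ζ hζ, one_mul] at hu
  rw [mul_div_cancel_left₀ _ hz0]
  have he0 : w - 1 ≠ 0 := by
    rintro h
    exact hne (by rw [sub_eq_zero.1 h, mul_one])
  have hR := valuation_zpow_sub_linear_le v hv hw
  have hve0 : 0 < v (w - 1) := zero_lt_iff.2 (by simpa using he0)
  have hsq : v (w - 1) ^ 2 < v (w - 1) := by
    rw [pow_two]; exact mul_lt_of_lt_one_left hve0 hw
  have hR' : ∀ n : ℤ, v (w ^ n - 1 - n * (w - 1)) < v (w - 1) := fun n => (hR n).trans_lt hsq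
  have hint : ∀ m : ℤ, v (m : K) ≤ 1 := by
    intro m
    rcases eq_or_ne (m : ℂ) 0 with h | h
    · have : (m : K) = algebraMap ℂ K m := by simp
      rw [this, h]; simp
    · simpa using (hv m h).le
  have hwn : ∀ n : ℤ, v (w ^ n - 1) ≤ v (w - 1) := by
    intro n
    have : w ^ n - 1 = (w ^ n - 1 - n * (w - 1)) + n * (w - 1) := by ring
    rw [this]
    refine v.map_add_le (hR' n).le ?_
    rw [map_mul]; exact mul_le_of_le_one_left' (hint n)
  have hy1 : ∀ n : ℤ, 0 < n → v (y ^ n) < 1 := fun n hn => by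
    simpa using valuation_zpow_lt_zpow v hy0 hy hn
  have hzab : ζ ^ b = ζ ^ a := by
    have h1 := valuation_zpow_sub_one_lt v hu1 hy0 hy ha hab E
    have h2 : v (algebraMap ℂ K (ζ ^ (b - a)) - 1) < 1 := by
      have h3 : algebraMap ℂ K (ζ ^ (b - a)) - 1 =
          ((algebraMap ℂ K ζ * w) ^ (b - a) - 1) -
            algebraMap ℂ K (ζ ^ (b - a)) * (w ^ (b - a) - 1) := by
        rw [mul_zpow, map_zpow₀]; ring
      rw [h3]
      refine v.map_sub_lt h1 ?_
      rw [map_mul, hv _ (zpow_ne_zero _ hζ), one_mul]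
      exact (hwn _).trans_lt hw
    have h4 := constant_eq_one_of_valuation v hv h2
    rwa [zpow_sub₀ hζ, div_eq_one_iff_eq (zpow_ne_zero a hζ)] at h4
  have hua : (algebraMap ℂ K ζ * w) ^ a = algebraMap ℂ K (ζ ^ a) * w ^ a := by
    rw [mul_zpow, map_zpow₀]
  have hub : (algebraMap ℂ K ζ * w) ^ b = algebraMap ℂ K (ζ ^ a) * w ^ b := by
    rw [mul_zpow, ← hzab, map_zpow₀]
  rw [hua, hub] at E
  have hvz := hv _ (zpow_ne_zero a hζ)
  have hza : ζ ^ a - 1 ≠ 0 → v (1 - algebraMap ℂ K (ζ ^ a)) = 1 := by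
    intro h
    have := hv _ h
    rwa [map_sub, map_one, v.map_sub_swap] at this
  have hab' : v (((a - b : ℤ) : K)) = 1 := by
    have h : (((a - b : ℤ)) : ℂ) ≠ 0 := by
      exact_mod_cast (by omega : a - b ≠ 0)
    simpa using hv _ h
  generalize hZ : algebraMap ℂ K (ζ ^ a) = Z at *
  -- the difference of the two sides, up to terms smaller than `w - 1`
  have hlhs : v (w ^ a - w ^ b - ((a - b : ℤ) : K) * (w - 1)) < v (w - 1) := by
    have : w ^ a - w ^ b - ((a - b : ℤ) : K) * (w - 1) =
        (w ^ a - 1 - a * (w - 1)) - (w ^ b - 1 - b * (w - 1)) := by push_cast; ring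
    rw [this]
    exact v.map_sub_lt (hR' a) (hR' b)
  have hlhs' : v (w ^ a - w ^ b) = v (w - 1) := by
    have h1 : v (((a - b : ℤ) : K) * (w - 1)) = v (w - 1) := by rw [map_mul, hab', one_mul]
    rw [← h1] at hlhs
    have := v.map_add_eq_of_lt_right hlhs
    rw [sub_add_cancel] at this
    rw [this, h1]
  have hz1 : ζ ^ a ≠ 1 := by
    intro h
    have hZ1 : Z = 1 := by rw [← hZ, h, map_one]
    rw [hZ1] at E
    have h2 : v (w ^ a - w ^ b) < v (w - 1) := by
      have h3 : w ^ a - w ^ b = y ^ b * (w ^ a - 1) - y ^ a * (w ^ b - 1) := by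
        linear_combination E
      rw [h3]
      apply v.map_sub_lt
      · rw [map_mul]
        exact (mul_le_mul_right (hwn a) _).trans_lt
          (mul_lt_of_lt_one_left hve0 (hy1 b (ha.trans hab)))
      · rw [map_mul]
        exact (mul_le_mul_right (hwn b) _).trans_lt (mul_lt_of_lt_one_left hve0 (hy1 a ha))
    exact absurd hlhs' h2.ne
  have hZ1 := hza (sub_ne_zero.2 hz1)
  have hvy : 0 < v (y ^ a) := zero_lt_iff.2 ((map_ne_zero v).2 (zpow_ne_zero a hy0))
  -- the remainder on the right-hand side
  have hsmall : v (-(y ^ a * (Z * (w ^ b - 1))) - y ^ b * (1 - Z * w ^ a)) < v (y ^ a) := by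
    apply v.map_sub_lt
    · rw [v.map_neg, map_mul, map_mul, hvz, one_mul]
      exact mul_lt_of_lt_one_right hvy ((hwn b).trans_lt hw)
    · rw [map_mul]
      refine lt_of_le_of_lt (mul_le_of_le_one_right' ?_) (valuation_zpow_lt_zpow v hy0 hy hab)
      refine v.map_sub_le (by simp) ?_
      rw [← hua]; exact (hpow a).le
  have hrhs : v (w - 1) = v (y ^ a) := by
    rw [← hlhs', ← one_mul (v (w ^ a - w ^ b)), ← hvz, ← map_mul]
    have h1 : Z * (w ^ a - w ^ b) = (-(y ^ a * (Z * (w ^ b - 1))) - y ^ b * (1 - Z * w ^ a)) +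
        y ^ a * (1 - Z) := by linear_combination E
    have h2 : v (y ^ a * (1 - Z)) = v (y ^ a) := by rw [map_mul, hZ1, mul_one]
    rw [h1, v.map_add_eq_of_lt_right (by rw [h2]; exact hsmall), h2]
  refine ⟨hzab, by rw [hrhs, map_zpow₀], ?_⟩
  have h1 : algebraMap ℂ K (ζ ^ a * (a - b)) * (w - 1) - y ^ a * algebraMap ℂ K (1 - ζ ^ a) =
      (-(y ^ a * (Z * (w ^ b - 1))) - y ^ b * (1 - Z * w ^ a)) -
        Z * (w ^ a - w ^ b - ((a - b : ℤ) : K) * (w - 1)) := by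
    rw [map_mul, map_sub, map_sub, hZ]
    simp only [map_intCast, map_one]
    push_cast
    linear_combination E
  rw [h1]
  apply v.map_sub_lt
  · rw [hrhs]; exact hsmall
  · rw [map_mul, hvz, one_mul]; exact hlhs

end Valuation

/-! ### Orders of roots of unity, end gaps and reflection of supports. -/

theorem exists_order_of_zpow_eq_one {K : Type} [Field K] {ζ : K} (h0 : ζ ≠ 0) {d : ℤ}
    (hd : d ≠ 0) (hζ : ζ ^ d = 1) : ∃ k : ℕ, 0 < k ∧ (ζ ≠ 1 → 2 ≤ k) ∧
      ∀ n : ℤ, ζ ^ n = 1 ↔ (k : ℤ) ∣ n := by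
  have hz : ∀ n : ℤ, Units.mk0 ζ h0 ^ n = 1 ↔ ζ ^ n = 1 := by
    intro n
    rw [← Units.val_inj, Units.val_zpow_eq_zpow_val]
    simp
  have hfin : 0 < orderOf (Units.mk0 ζ h0) :=
    orderOf_pos_iff.2 (isOfFinOrder_iff_zpow_eq_one.2 ⟨d, hd, (hz d).2 hζ⟩)
  refine ⟨orderOf (Units.mk0 ζ h0), hfin, fun h1 => ?_, fun n => ?_⟩
  · have : orderOf (Units.mk0 ζ h0) ≠ 1 := by
      rw [Ne, orderOf_eq_one_iff]
      intro h
      exact h1 (by simpa using congrArg Units.val h)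
    omega
  · rw [orderOf_dvd_iff_zpow_eq_one, hz]

theorem exists_three_least {B : Finset ℤ} (hB : 3 ≤ B.card) :
    ∃ m ∈ B, ∃ s ∈ B, m < s ∧ (∀ b ∈ B, b = m ∨ s ≤ b) ∧ (∀ b ∈ B, m ≤ b) ∧ ∃ c ∈ B, s < c := by
  have h1 : B.Nonempty := Finset.card_pos.1 (by omega)
  let m := B.min' h1
  have hc : (B.erase m).card = B.card - 1 := Finset.card_erase_of_mem (B.min'_mem h1)
  have h2 : (B.erase m).Nonempty := Finset.card_pos.1 (by omega)
  let s := (B.erase m).min' h2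
  have hs : s ∈ B.erase m := (B.erase m).min'_mem h2
  have hc' : ((B.erase m).erase s).card = B.card - 2 := by
    rw [Finset.card_erase_of_mem hs]; omega
  obtain ⟨c, hcm⟩ : ((B.erase m).erase s).Nonempty := Finset.card_pos.1 (by omega)
  have hle : ∀ b ∈ B, m ≤ b := fun b hb => B.min'_le b hb
  have hle' : ∀ b ∈ B.erase m, s ≤ b := fun b hb => (B.erase m).min'_le b hb
  simp only [Finset.mem_erase] at hs hcm
  refine ⟨m, B.min'_mem h1, s, hs.2, lt_of_le_of_ne (hle s hs.2) (Ne.symm hs.1), ?_, hle, c, hcm.2.2,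
    lt_of_le_of_ne (hle' c (by simp [hcm])) (Ne.symm hcm.1)⟩
  intro b hb
  by_cases h : b = m
  · exact Or.inl h
  · exact Or.inr (hle' b (by simp [h, hb]))

theorem leftGap_of {B : Finset ℤ} {m s : ℤ} (hm : m ∈ B) (hs : s ∈ B) (hms : m + 1 < s)
    (hB : ∀ b ∈ B, b = m ∨ s ≤ b) : LeftGap B := by
  refine ⟨m, s, ⟨hm, fun b hb => ?_⟩, ⟨⟨hs, ?_⟩, ?_⟩, by omega⟩
  · rcases hB b hb with h | h <;> omega
  · simp only [Set.mem_singleton_iff]; omega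
  · rintro b ⟨hb, hbm⟩
    exact (hB b hb).resolve_left hbm

theorem rightGap_of {B : Finset ℤ} {m s : ℤ} (hm : m ∈ B) (hs : s ∈ B) (hms : s + 1 < m)
    (hB : ∀ b ∈ B, b = m ∨ b ≤ s) : RightGap B := by
  refine ⟨m, s, ⟨hm, fun b hb => ?_⟩, ⟨⟨hs, ?_⟩, ?_⟩, by omega⟩
  · rcases hB b hb with h | h <;> omega
  · simp only [Set.mem_singleton_iff]; omega
  · rintro b ⟨hb, hbm⟩
    exact (hB b hb).resolve_left hbm

theorem rightGap_of_leftGap_neg {B : Finset ℤ} (h : LeftGap (B.image Neg.neg)) : RightGap B := by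
  obtain ⟨a, b, ⟨ha, ha'⟩, ⟨⟨hb, hba⟩, hb'⟩, hab⟩ := h
  simp only [Finset.coe_image, Set.mem_image, SetLike.mem_coe] at ha hb
  obtain ⟨a, ha, rfl⟩ := ha
  obtain ⟨b, hb, rfl⟩ := hb
  refine rightGap_of ha hb (by omega) fun c hc => ?_
  by_contra! hcon
  have : -b ≤ -c := hb' ⟨by simpa using hc, by simpa using hcon.1⟩
  omega

theorem leftGap_of_rightGap_neg {B : Finset ℤ} (h : RightGap (B.image Neg.neg)) : LeftGap B := by
  obtain ⟨a, b, ⟨ha, ha'⟩, ⟨⟨hb, hba⟩, hb'⟩, hab⟩ := h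
  simp only [Finset.coe_image, Set.mem_image, SetLike.mem_coe] at ha hb
  obtain ⟨a, ha, rfl⟩ := ha
  obtain ⟨b, hb, rfl⟩ := hb
  refine leftGap_of ha hb (by omega) fun c hc => ?_
  by_contra! hcon
  have : -c ≤ -b := hb' ⟨by simpa using hc, by simpa using hcon.1⟩
  omega

theorem shiftsTo_of_neg {k : ℕ} {B : Finset ℤ} (h : ShiftsTo k (B.image Neg.neg)) :
    ShiftsTo k B := by
  obtain ⟨m, hm⟩ := h
  refine ⟨-m, fun b hb => ?_⟩
  obtain ⟨c, hc⟩ := hm (-b) (by simpa using hb)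
  exact ⟨-c, by rw [mul_neg, ← hc]; ring⟩

/-! ### Two roots of equal valuation and a third of smaller valuation. -/

section Valuation

variable {K : Type} [Field K] [Algebra ℂ K]
variable {Γ : Type} [LinearOrderedCommGroupWithZero Γ] (v : Valuation K Γ)

/-- The ratio `u = x / y` is near a root of unity `ζ`. If `u = ζ`, its order is a modulus for
condition 1. Otherwise the leading terms of the relations show that both supports are translates of
one three-element set, and its two gaps decide between the remaining alternatives. -/
theorem conditions_of_valuation_lt (hv : ∀ c : ℂ, c ≠ 0 → v (algebraMap ℂ K c) = 1)
    {B₁ B₂ : Finset ℤ} (hB₁ : 3 ≤ B₁.card) (hB₂ : 3 ≤ B₂.card) {x y z : K}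
    (hx : x ≠ 0) (hy : y ≠ 0) (hz : z ≠ 0) (hne : x ≠ y) (hxy : v x = v y) (hzy : v z < v y)
    (h₁ : MinorsVanish B₁ x y z) (h₂ : MinorsVanish B₂ x y z) :
    CondOne B₁ B₂ ∨ CondThree B₁ B₂ ∨ CondFour B₁ B₂ ∨
      ∀ b ∈ B₁, ∀ b' ∈ B₁, b - b' ≤ 2 := by
  obtain ⟨m₁, hm₁, s₁, hs₁, hms₁, hleast₁, hle₁, c₁, hc₁, hsc₁⟩ := exists_three_least hB₁
  obtain ⟨m₂, hm₂, s₂, hs₂, hms₂, hleast₂, hle₂, c₂, hc₂, hsc₂⟩ := exists_three_least hB₂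
  have hvy : v y ≠ 0 := (map_ne_zero v).2 hy
  have E₁ : ∀ b ∈ B₁, _ := fun b hb => h₁.normalized hx hy hz hm₁ hs₁ hb
  have E₂ : ∀ b ∈ B₂, _ := fun b hb => h₂.normalized hx hy hz hm₂ hs₂ hb
  have hu0 : x / y ≠ 0 := div_ne_zero hx hy
  have hw0 : z / y ≠ 0 := div_ne_zero hz hy
  have hu1 : v (x / y) = 1 := by rw [map_div₀, hxy, div_self hvy]
  have hw1 : v (z / y) < 1 := by
    rw [map_div₀]; exact (div_lt_one₀ (zero_lt_iff.2 hvy)).2 hzy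
  have hune : x / y ≠ 1 := fun h => hne ((div_eq_one_iff_eq hy).1 h)
  generalize x / y = u at *
  generalize z / y = w at *
  have hnear := valuation_zpow_sub_one_lt v hu1 hw0 hw1 (sub_pos.2 hms₁)
    (sub_lt_sub_right hsc₁ m₁) (E₁ c₁ hc₁)
  obtain ⟨ζ, hζd, hζ0, hζ⟩ := exists_root_of_unity_near v
    (sub_pos.2 (sub_lt_sub_right hsc₁ m₁)) hnear
  by_cases huζ : u = algebraMap ℂ K ζ
  · left
    subst huζ
    have hζ1 : ζ ≠ 1 := by rintro rfl; simp at hune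
    obtain ⟨k, -, hk, hdvd⟩ := exists_order_of_zpow_eq_one hζ0 (by omega) hζd
    have aux : ∀ {B : Finset ℤ} {m s c : ℤ}, m < s → s < c → c ∈ B → (∀ b ∈ B, b = m ∨ s ≤ b) →
        (∀ b ∈ B, algebraMap ℂ K ζ ^ (s - m) - algebraMap ℂ K ζ ^ (b - m) =
          w ^ (s - m) * (1 - algebraMap ℂ K ζ ^ (b - m)) -
          w ^ (b - m) * (1 - algebraMap ℂ K ζ ^ (s - m))) → ShiftsTo k B := by
      intro B m s c hms hsc hc hleast E
      refine ⟨-m, fun b hb => ?_⟩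
      rw [← sub_eq_add_neg, ← hdvd]
      have key : ∀ b ∈ B, s < b → ζ ^ (s - m) = 1 ∧ ζ ^ (b - m) = 1 := fun b hb hsb =>
        zpow_eq_one_of_constant v hv hζ0 hw0 hw1 (by omega) (by omega) (E b hb)
      rcases hleast b hb with rfl | h
      · simp
      · rcases h.eq_or_lt with rfl | h
        · exact (key c hc hsc).1
        · exact (key b hb h).2
    exact ⟨k, hk hζ1, aux hms₁ hsc₁ hc₁ hleast₁ E₁, aux hms₂ hsc₂ hc₂ hleast₂ E₂⟩
  · right
    have L₁ : ∀ b ∈ B₁, s₁ < b → _ := fun b hb hsb =>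
      leading_terms v hv hζ0 hζ huζ hw0 hw1 (sub_pos.2 hms₁) (sub_lt_sub_right hsb m₁) (E₁ b hb)
    have L₂ : ∀ b ∈ B₂, s₂ < b → _ := fun b hb hsb =>
      leading_terms v hv hζ0 hζ huζ hw0 hw1 (sub_pos.2 hms₂) (sub_lt_sub_right hsb m₂) (E₂ b hb)
    -- The same quantity `v (u / ζ - 1)` equals `v w` raised to the first gap of either support.
    have hgap : s₁ - m₁ = s₂ - m₂ := by
      have h := (L₁ c₁ hc₁ hsc₁).2.1.symm.trans (L₂ c₂ hc₂ hsc₂).2.1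
      rw [← map_zpow₀, ← map_zpow₀] at h
      rcases lt_trichotomy (s₁ - m₁) (s₂ - m₂) with hlt | heq | hlt
      · exact absurd h (valuation_zpow_lt_zpow v hw0 hw1 hlt).ne'
      · exact heq
      · exact absurd h (valuation_zpow_lt_zpow v hw0 hw1 hlt).ne
    rw [← hgap] at L₂
    have huniq : ∀ b b' : ℤ,
        v (algebraMap ℂ K (ζ ^ (s₁ - m₁) * (((s₁ - m₁ : ℤ) : ℂ) - (b : ℤ))) *
            (u / algebraMap ℂ K ζ - 1) -
          w ^ (s₁ - m₁) * algebraMap ℂ K (1 - ζ ^ (s₁ - m₁))) < v (u / algebraMap ℂ K ζ - 1) →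
        v (algebraMap ℂ K (ζ ^ (s₁ - m₁) * (((s₁ - m₁ : ℤ) : ℂ) - (b' : ℤ))) *
            (u / algebraMap ℂ K ζ - 1) -
          w ^ (s₁ - m₁) * algebraMap ℂ K (1 - ζ ^ (s₁ - m₁))) < v (u / algebraMap ℂ K ζ - 1) →
        b = b' := by
      -- Subtracting the two estimates cancels the term in `w` and leaves a nonzero constant times
      -- `u / ζ - 1`, which is not smaller than `u / ζ - 1`. So the leading coefficient determines
      -- the exponent.
      intro b b' hb hb'
      by_contra hbb
      have h := v.map_sub_lt hb hb'
      have hne0 : ζ ^ (s₁ - m₁) * ((b' : ℂ) - b) ≠ 0 :=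
        mul_ne_zero (zpow_ne_zero _ hζ0) (sub_ne_zero.2 (by exact_mod_cast Ne.symm hbb))
      have h2 : ∀ (A A' e W : K), A * e - W - (A' * e - W) = (A - A') * e := by intros; ring
      rw [h2, ← map_sub, map_mul] at h
      rw [show ζ ^ (s₁ - m₁) * (((s₁ - m₁ : ℤ) : ℂ) - (b : ℤ)) -
        ζ ^ (s₁ - m₁) * (((s₁ - m₁ : ℤ) : ℂ) - (b' : ℤ)) = ζ ^ (s₁ - m₁) * ((b' : ℂ) - b) by ring,
        hv _ hne0, one_mul] at h
      exact lt_irrefl _ h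
    have hu₁ : ∀ b ∈ B₁, s₁ < b → b - m₁ = c₁ - m₁ := fun b hb hsb =>
      huniq _ _ (L₁ b hb hsb).2.2 (L₁ c₁ hc₁ hsc₁).2.2
    have hu₂ : ∀ b ∈ B₂, s₂ < b → b - m₂ = c₁ - m₁ := fun b hb hsb =>
      huniq _ _ (L₂ b hb hsb).2.2 (L₁ c₁ hc₁ hsc₁).2.2
    have hc₂' := hu₂ c₂ hc₂ hsc₂
    by_cases hs : m₁ + 1 < s₁
    · exact Or.inl ⟨leftGap_of hm₁ hs₁ hs hleast₁, leftGap_of hm₂ hs₂ (by omega) hleast₂⟩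
    · right
      by_cases hc : s₁ + 1 < c₁
      · left
        refine ⟨rightGap_of hc₁ hs₁ hc fun b hb => ?_, rightGap_of hc₂ hs₂ (by omega) fun b hb => ?_⟩
        · by_cases h : s₁ < b
          · have := hu₁ b hb h; left; omega
          · right; omega
        · by_cases h : s₂ < b
          · have := hu₂ b hb h; left; omega
          · right; omega
      · right
        intro b hb b' hb'
        have h1 := hle₁ b' hb'
        by_cases h : s₁ < b
        · have := hu₁ b hb h; omega
        · omega

end Valuation

/-! ### Proportional rows, and the remaining positions of the three valuations. -/

section Proportional

variable {K : Type} [Field K]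

/-- Two monomial rows are proportional on `B`. -/
def RowsProportional (B : Finset ℤ) (x y : K) : Prop :=
  ∀ a ∈ B, ∀ b ∈ B, x ^ a * y ^ b = x ^ b * y ^ a

theorem rowsProportional_iff {B : Finset ℤ} {x y : K} (hx : x ≠ 0) (hy : y ≠ 0) :
    RowsProportional B x y ↔ ∀ a ∈ B, ∀ b ∈ B, (x / y) ^ (a - b) = 1 := by
  refine forall₄_congr fun a _ b _ => ?_
  have h1 := zpow_ne_zero a hy
  have h3 := zpow_ne_zero b hx
  rw [div_zpow, zpow_sub₀ hx, zpow_sub₀ hy, div_div_div_eq, div_eq_one_iff_eq (mul_ne_zero h3 h1)]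

theorem RowsProportional.exists_zpow_eq_one {B : Finset ℤ} (hB : 2 ≤ B.card) {x y : K} (hx : x ≠ 0)
    (hy : y ≠ 0) (h : RowsProportional B x y) :
    ∃ d : ℤ, d ≠ 0 ∧ (x / y) ^ d = 1 := by
  obtain ⟨a, ha, b, hb, hab⟩ := Finset.one_lt_card.1 hB
  exact ⟨a - b, sub_ne_zero.2 hab, (rowsProportional_iff hx hy).1 h a ha b hb⟩

end Proportional

section Valuation

variable {K : Type} [Field K]
variable {Γ : Type} [LinearOrderedCommGroupWithZero Γ] (v : Valuation K Γ)

/-- With three distinct valuations a single term of the expanded minor strictly dominates all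
others. -/
theorem not_minorsVanish_of_valuation_lt {B : Finset ℤ} (hB : 3 ≤ B.card) {x y z : K}
    (hx : x ≠ 0) (hy : y ≠ 0) (hxy : v x < v y) (hyz : v y < v z) : ¬ MinorsVanish B x y z := by
  intro h
  obtain ⟨m, hm, s, hs, hms, -, -, c, hc, hsc⟩ := exists_three_least hB
  have hz : z ≠ 0 := by rintro rfl; simp at hyz
  have hvy : v y ≠ 0 := (map_ne_zero v).2 hy
  have hvz : v z ≠ 0 := (map_ne_zero v).2 hz
  have E := h.normalized hx hy hz hm hs hc
  have hu0 : x / y ≠ 0 := div_ne_zero hx hy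
  have hw0 : y / z ≠ 0 := div_ne_zero hy hz
  have hu1 : v (x / y) < 1 := by
    rw [map_div₀]; exact (div_lt_one₀ (zero_lt_iff.2 hvy)).2 hxy
  have hw1 : v (y / z) < 1 := by
    rw [map_div₀]; exact (div_lt_one₀ (zero_lt_iff.2 hvz)).2 hyz
  rw [← inv_div y z] at E
  generalize x / y = u at *
  generalize y / z = w at *
  have hp : 0 < s - m := by omega
  have hpq : s - m < c - m := by omega
  generalize s - m = p at *
  generalize c - m = q at *
  have hus : ∀ n : ℤ, 0 < n → v (u ^ n) < 1 := fun n hn => by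
    simpa using valuation_zpow_lt_zpow v hu0 hu1 hn
  have hwp := zpow_ne_zero p hw0
  have hwq := zpow_ne_zero q hw0
  have hwqp : v (w ^ q) < v (w ^ p) := valuation_zpow_lt_zpow v hw0 hw1 hpq
  have hwp1 : v (w ^ p) < 1 := by simpa using valuation_zpow_lt_zpow v hw0 hw1 hp
  have hvq : 0 < v (w ^ q) := zero_lt_iff.2 ((map_ne_zero v).2 hwq)
  have hvp : 0 < v (w ^ p) := zero_lt_iff.2 ((map_ne_zero v).2 hwp)
  have E' : w ^ p * (1 - u ^ p) = w ^ q * (1 - u ^ q) - w ^ p * w ^ q * (u ^ p - u ^ q) := by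
    rw [inv_zpow, inv_zpow] at E
    field_simp at E
    linear_combination E
  have h1 : v (w ^ p * (1 - u ^ p)) = v (w ^ p) := by
    rw [map_mul, v.map_one_sub_of_lt (hus p hp), mul_one]
  have h2 : v (w ^ q * (1 - u ^ q) - w ^ p * w ^ q * (u ^ p - u ^ q)) < v (w ^ p) := by
    apply v.map_sub_lt
    · rw [map_mul, v.map_one_sub_of_lt (hus q (hp.trans hpq)), mul_one]; exact hwqp
    · rw [map_mul, map_mul, mul_assoc]
      refine mul_lt_of_lt_one_right hvp ?_
      exact mul_lt_one_of_lt_of_le (hwqp.trans hwp1)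
        (v.map_sub_le (hus p hp).le (hus q (hp.trans hpq)).le)
  rw [← E', h1] at h2
  exact lt_irrefl _ h2

variable [Algebra ℂ K]

/-- Inverting the roots and negating the supports reverses the inequality of valuations and
exchanges conditions 3 and 4. -/
theorem conditions_of_valuation_gt (hv : ∀ c : ℂ, c ≠ 0 → v (algebraMap ℂ K c) = 1)
    {B₁ B₂ : Finset ℤ} (hB₁ : 3 ≤ B₁.card) (hB₂ : 3 ≤ B₂.card) {x y z : K}
    (hx : x ≠ 0) (hy : y ≠ 0) (hz : z ≠ 0) (hne : x ≠ y) (hxy : v x = v y) (hzy : v y < v z)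
    (h₁ : MinorsVanish B₁ x y z) (h₂ : MinorsVanish B₂ x y z) :
    CondOne B₁ B₂ ∨ CondThree B₁ B₂ ∨ CondFour B₁ B₂ ∨
      ∀ b ∈ B₁, ∀ b' ∈ B₁, b - b' ≤ 2 := by
  have hcard : ∀ B : Finset ℤ, (B.image Neg.neg).card = B.card := fun B =>
    Finset.card_image_of_injective B neg_injective
  have hvy : v y ≠ 0 := (map_ne_zero v).2 hy
  have hvz : v z ≠ 0 := (map_ne_zero v).2 hz
  rcases conditions_of_valuation_lt v hv (B₁ := B₁.image Neg.neg) (B₂ := B₂.image Neg.neg)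
    (by rwa [hcard]) (by rwa [hcard]) (inv_ne_zero hx) (inv_ne_zero hy) (inv_ne_zero hz)
    (fun h => hne (inv_injective h)) (by rw [map_inv₀, map_inv₀, hxy])
    (by rw [map_inv₀, map_inv₀]; exact (inv_lt_inv₀ (zero_lt_iff.2 hvz) (zero_lt_iff.2 hvy)).2 hzy)
    h₁.inv h₂.inv with ⟨k, hk, hs₁, hs₂⟩ | ⟨g₁, g₂⟩ | ⟨g₁, g₂⟩ | h
  · exact Or.inl ⟨k, hk, shiftsTo_of_neg hs₁, shiftsTo_of_neg hs₂⟩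
  · exact Or.inr (Or.inr (Or.inl ⟨rightGap_of_leftGap_neg g₁, rightGap_of_leftGap_neg g₂⟩))
  · exact Or.inr (Or.inl ⟨leftGap_of_rightGap_neg g₁, leftGap_of_rightGap_neg g₂⟩)
  · refine Or.inr (Or.inr (Or.inr fun b hb b' hb' => ?_))
    have := h (-b') (by simpa using hb') (-b) (by simpa using hb)
    omega

theorem conditions_of_valuation_ne (hv : ∀ c : ℂ, c ≠ 0 → v (algebraMap ℂ K c) = 1)
    {B₁ B₂ : Finset ℤ} (hB₁ : 3 ≤ B₁.card) (hB₂ : 3 ≤ B₂.card) {x y z : K}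
    (hx : x ≠ 0) (hy : y ≠ 0) (hz : z ≠ 0) (hxy : x ≠ y) (hxz : x ≠ z) (hyz : y ≠ z)
    (hne : ¬ (v x = v z ∧ v y = v z))
    (h₁ : MinorsVanish B₁ x y z) (h₂ : MinorsVanish B₂ x y z) :
    CondOne B₁ B₂ ∨ CondThree B₁ B₂ ∨ CondFour B₁ B₂ ∨
      ∀ b ∈ B₁, ∀ b' ∈ B₁, b - b' ≤ 2 := by
  have two : ∀ {x y z : K}, x ≠ 0 → y ≠ 0 → z ≠ 0 → x ≠ y → v x = v y → v z ≠ v y →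
      MinorsVanish B₁ x y z → MinorsVanish B₂ x y z →
      CondOne B₁ B₂ ∨ CondThree B₁ B₂ ∨ CondFour B₁ B₂ ∨
        ∀ b ∈ B₁, ∀ b' ∈ B₁, b - b' ≤ 2 := by
    intro x y z hx hy hz hxy hv1 hv2 h₁ h₂
    rcases lt_or_gt_of_ne hv2 with h | h
    · exact conditions_of_valuation_lt v hv hB₁ hB₂ hx hy hz hxy hv1 h h₁ h₂
    · exact conditions_of_valuation_gt v hv hB₁ hB₂ hx hy hz hxy hv1 h h₁ h₂
  by_cases e1 : v x = v y
  · exact two hx hy hz hxy e1 (fun e => hne ⟨e1.trans e.symm, e.symm⟩) h₁ h₂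
  by_cases e2 : v x = v z
  · exact two hx hz hy hxz e2 (fun e => hne ⟨e2, e⟩) h₁.swap_right h₂.swap_right
  by_cases e3 : v y = v z
  · exact two hy hz hx hyz e3 e2 h₁.swap_left.swap_right h₂.swap_left.swap_right
  exfalso
  rcases lt_or_gt_of_ne e1 with a | a <;> rcases lt_or_gt_of_ne e2 with b | b <;>
    rcases lt_or_gt_of_ne e3 with c | c
  · exact not_minorsVanish_of_valuation_lt v hB₁ hx hy a c h₁
  · exact not_minorsVanish_of_valuation_lt v hB₁ hx hz b c h₁.swap_right
  · exact absurd (a.trans c) b.not_gt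
  · exact not_minorsVanish_of_valuation_lt v hB₁ hz hx b a h₁.swap_right.swap_left
  · exact not_minorsVanish_of_valuation_lt v hB₁ hy hx a b h₁.swap_left
  · exact absurd (b.trans c) a.not_gt
  · exact not_minorsVanish_of_valuation_lt v hB₁ hy hz c b h₁.swap_left.swap_right
  · exact not_minorsVanish_of_valuation_lt v hB₁ hz hy c a h₁.swap_right.swap_left.swap_right

end Valuation

section Ratios

variable {K : Type} [Field K] [Algebra ℂ K]

theorem ratio_mem_range_of_minorsVanish {B₁ B₂ : Finset ℤ} (hB₁ : 3 ≤ B₁.card)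
    (hB₂ : 3 ≤ B₂.card) {x y z : K}
    (hx : x ≠ 0) (hy : y ≠ 0) (hz : z ≠ 0) (hxy : x ≠ y) (hxz : x ≠ z) (hyz : y ≠ z)
    (h₁ : MinorsVanish B₁ x y z) (h₂ : MinorsVanish B₂ x y z)
    (hcond : ¬ (CondOne B₁ B₂ ∨ CondThree B₁ B₂ ∨ CondFour B₁ B₂ ∨
      ∀ b ∈ B₁, ∀ b' ∈ B₁, b - b' ≤ 2)) :
    (∃ c : ℂ, algebraMap ℂ K c = x / z) ∧ ∃ c : ℂ, algebraMap ℂ K c = y / z := by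
  constructor
  · by_contra h
    obtain ⟨A, hA, hlt⟩ := exists_valuation_lt_one h
    refine hcond (conditions_of_valuation_ne A.valuation hA hB₁ hB₂ hx hy hz hxy hxz hyz
      (fun e => ?_) h₁ h₂)
    rw [map_div₀, e.1, div_self ((map_ne_zero _).2 hz)] at hlt
    exact lt_irrefl _ hlt
  · by_contra h
    obtain ⟨A, hA, hlt⟩ := exists_valuation_lt_one h
    refine hcond (conditions_of_valuation_ne A.valuation hA hB₁ hB₂ hx hy hz hxy hxz hyz
      (fun e => ?_) h₁ h₂)
    rw [map_div₀, e.2, div_self ((map_ne_zero _).2 hz)] at hlt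
    exact lt_irrefl _ hlt

end Ratios

/-! ### Roots of unity and collinear points. -/

theorem conj_eq_inv_of_zpow_eq_one {c : ℂ} {d : ℤ} (hd : d ≠ 0) (hc : c ^ d = 1) :
    starRingEnd ℂ c = c⁻¹ :=
  (Complex.inv_eq_conj (Complex.norm_eq_one_of_pow_eq_one (zpow_natAbs_eq_one hc)
    (Int.natAbs_ne_zero.2 hd))).symm

theorem condOne_of_zpow_eq {B₁ B₂ : Finset ℤ} {K : Type} [Field K] {r : K} (hr0 : r ≠ 0)
    (hr1 : r ≠ 1) {d : ℤ} (hd : d ≠ 0) (hrd : r ^ d = 1)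
    (h₁ : ∀ a ∈ B₁, ∀ b ∈ B₁, r ^ a = r ^ b) (h₂ : ∀ a ∈ B₂, ∀ b ∈ B₂, r ^ a = r ^ b) :
    CondOne B₁ B₂ := by
  obtain ⟨k, -, hk, hdvd⟩ := exists_order_of_zpow_eq_one hr0 hd hrd
  have aux : ∀ B : Finset ℤ, (∀ a ∈ B, ∀ b ∈ B, r ^ a = r ^ b) → ShiftsTo k B := by
    intro B h
    rcases B.eq_empty_or_nonempty with rfl | ⟨m, hm⟩
    · exact ⟨0, by simp⟩
    · refine ⟨-m, fun b hb => ?_⟩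
      rw [← sub_eq_add_neg, ← hdvd, zpow_sub₀ hr0, h b hb m hm, div_self (zpow_ne_zero _ hr0)]
  exact ⟨k, hk hr1, aux B₁ h₁, aux B₂ h₂⟩

/-- Three points of the real torus lying on a complex line. -/
theorem torus_line {α₁ α₂ α₃ β₁ β₂ β₃ : ℂ}
    (a₁ : starRingEnd ℂ α₁ = α₁⁻¹) (a₂ : starRingEnd ℂ α₂ = α₂⁻¹) (a₃ : starRingEnd ℂ α₃ = α₃⁻¹)
    (b₁ : starRingEnd ℂ β₁ = β₁⁻¹) (b₂ : starRingEnd ℂ β₂ = β₂⁻¹) (b₃ : starRingEnd ℂ β₃ = β₃⁻¹)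
    (ha₁ : α₁ ≠ 0) (ha₂ : α₂ ≠ 0) (ha₃ : α₃ ≠ 0) (hb₁ : β₁ ≠ 0) (hb₂ : β₂ ≠ 0) (hb₃ : β₃ ≠ 0)
    (h : (α₂ - α₁) * (β₃ - β₁) = (α₃ - α₁) * (β₂ - β₁)) :
    (α₁ = α₂ ∧ β₁ = β₂) ∨ (α₁ = α₃ ∧ β₁ = β₃) ∨ (α₂ = α₃ ∧ β₂ = β₃) ∨ (α₁ = α₂ ∧ α₁ = α₃) ∨
      (β₁ = β₂ ∧ β₁ = β₃) ∨ (α₁ * β₂ = α₂ * β₁ ∧ α₁ * β₃ = α₃ * β₁) := by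
  -- Conjugation inverts every coordinate and gives a second equation; compared with the first, it
  -- yields `α₃ * β₂ = α₂ * β₃` outside the degenerate cases.
  have hc := congrArg (starRingEnd ℂ) h
  simp only [map_mul, map_sub, a₁, a₂, a₃, b₁, b₂, b₃] at hc
  have hc' : (α₁ - α₂) * (β₁ - β₃) * (α₃ * β₂) = (α₁ - α₃) * (β₁ - β₂) * (α₂ * β₃) := by
    field_simp at hc
    linear_combination hc
  by_cases h1 : α₂ = α₁
  · rw [h1, sub_self, zero_mul] at h
    rcases mul_eq_zero.1 h.symm with h2 | h2
    · exact Or.inr (Or.inr (Or.inr (Or.inl ⟨h1.symm, (sub_eq_zero.1 h2).symm⟩)))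
    · exact Or.inl ⟨h1.symm, (sub_eq_zero.1 h2).symm⟩
  by_cases h3 : β₃ = β₁
  · rw [h3, sub_self, mul_zero] at h
    rcases mul_eq_zero.1 h.symm with h2 | h2
    · exact Or.inr (Or.inl ⟨(sub_eq_zero.1 h2).symm, h3.symm⟩)
    · exact Or.inr (Or.inr (Or.inr (Or.inr (Or.inl ⟨(sub_eq_zero.1 h2).symm, h3.symm⟩))))
  have hne : (α₂ - α₁) * (β₃ - β₁) ≠ 0 := mul_ne_zero (sub_ne_zero.2 h1) (sub_ne_zero.2 h3)
  have hr : α₃ * β₂ = α₂ * β₃ := by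
    apply mul_left_cancel₀ hne
    linear_combination hc' - α₂ * β₃ * h
  by_cases h4 : β₂ = β₃
  · refine Or.inr (Or.inr (Or.inl ⟨?_, h4⟩))
    rw [h4] at hr
    exact (mul_right_cancel₀ hb₃ hr).symm
  · have h5 : (α₁ * β₂ - α₂ * β₁) * (β₂ - β₃) = 0 := by
      linear_combination β₂ * h - (β₁ - β₂) * hr
    have h6 : α₁ * β₂ = α₂ * β₁ :=
      sub_eq_zero.1 ((mul_eq_zero.1 h5).resolve_right (sub_ne_zero.2 h4))
    refine Or.inr (Or.inr (Or.inr (Or.inr (Or.inr ⟨h6, ?_⟩))))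
    apply mul_left_cancel₀ hb₂
    linear_combination β₃ * h6 - β₁ * hr

/-- The points `(c ^ b, d ^ b)`, `b ∈ B₂`, are collinear on the torus. If two distinct ones share a
first coordinate, a second one or a quotient, all do, and the order of `c`, `d` or `c / d` gives
condition 1. Otherwise there are at most two points, and their fibres split `B₂` modulo the lcm of
the orders. -/
theorem condOne_or_splitsAlong {B₁ B₂ : Finset ℤ} {c d : ℂ} {n : ℤ} (hn : n ≠ 0)
    (hc : c ^ n = 1) (hd : d ^ n = 1) (hc1 : c ≠ 1) (hd1 : d ≠ 1) (hcd : c ≠ d)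
    (hcB : ∀ a ∈ B₁, ∀ b ∈ B₁, c ^ a = c ^ b) (hdB : ∀ a ∈ B₁, ∀ b ∈ B₁, d ^ a = d ^ b)
    (hB : ∀ a ∈ B₂, ∀ b ∈ B₂, ∀ e ∈ B₂,
      (c ^ b - c ^ a) * (d ^ e - d ^ a) = (c ^ e - c ^ a) * (d ^ b - d ^ a)) :
    CondOne B₁ B₂ ∨ SplitsAlong B₂ B₁ := by
  classical
  have hc0 : c ≠ 0 := by rintro rfl; rw [zero_zpow _ hn] at hc; exact zero_ne_one hc
  have hd0 : d ≠ 0 := by rintro rfl; rw [zero_zpow _ hn] at hd; exact zero_ne_one hd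
  have conj : ∀ {r : ℂ}, r ^ n = 1 → ∀ b : ℤ, starRingEnd ℂ (r ^ b) = (r ^ b)⁻¹ := by
    intro r hr b
    rw [map_zpow₀, conj_eq_inv_of_zpow_eq_one hn hr, inv_zpow]
  have hA : ∀ b : ℤ, c ^ b ≠ 0 := fun b => zpow_ne_zero b hc0
  have hD : ∀ b : ℤ, d ^ b ≠ 0 := fun b => zpow_ne_zero b hd0
  have line : ∀ a ∈ B₂, ∀ b ∈ B₂, ∀ e ∈ B₂, _ := fun a ha b hb e he =>
    torus_line (conj hc a) (conj hc b) (conj hc e) (conj hd a) (conj hd b) (conj hd e)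
      (hA a) (hA b) (hA e) (hD a) (hD b) (hD e) (hB a ha b hb e he)
  by_cases hcol : ∃ a ∈ B₂, ∃ b ∈ B₂, ¬ (c ^ a = c ^ b ∧ d ^ a = d ^ b) ∧
      (c ^ a = c ^ b ∨ d ^ a = d ^ b ∨ c ^ a * d ^ b = c ^ b * d ^ a)
  · left
    obtain ⟨a, ha, b, hb, hne, h | h | h⟩ := hcol
    · have hdne : d ^ a ≠ d ^ b := fun e => hne ⟨h, e⟩
      have key : ∀ e ∈ B₂, c ^ e = c ^ a := by
        intro e he
        rcases line a ha b hb e he with l | l | l | l | l | l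
        · exact absurd l hne
        · exact l.1.symm
        · rw [h, l.1]
        · exact l.2.symm
        · exact absurd l.1 hdne
        · rw [h] at l
          exact absurd (mul_left_cancel₀ (hA b) l.1).symm hdne
      exact condOne_of_zpow_eq hc0 hc1 hn hc hcB fun a ha b hb => (key a ha).trans (key b hb).symm
    · have hcne : c ^ a ≠ c ^ b := fun e => hne ⟨e, h⟩
      have key : ∀ e ∈ B₂, d ^ e = d ^ a := by
        intro e he
        rcases line a ha b hb e he with l | l | l | l | l | l
        · exact absurd l hne
        · exact l.2.symm
        · rw [h, l.2]
        · exact absurd l.1 hcne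
        · exact l.2.symm
        · rw [h] at l
          exact absurd (mul_right_cancel₀ (hD b) l.1) hcne
      exact condOne_of_zpow_eq hd0 hd1 hn hd hdB fun a ha b hb => (key a ha).trans (key b hb).symm
    · have hcne : c ^ a ≠ c ^ b := by
        intro e
        rw [e] at h
        exact hne ⟨e, (mul_left_cancel₀ (hA b) h).symm⟩
      have hdne : d ^ a ≠ d ^ b := by
        intro e
        rw [e] at h
        exact hne ⟨mul_right_cancel₀ (hD b) h, e⟩
      have key : ∀ e ∈ B₂, (c / d) ^ e = (c / d) ^ a := by
        intro e he
        rw [div_zpow, div_zpow, div_eq_div_iff (hD e) (hD a)]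
        rcases line a ha b hb e he with l | l | l | l | l | l
        · exact absurd l hne
        · rw [l.1, l.2]
        · rw [← l.1, ← l.2, h]
        · exact absurd l.1 hcne
        · exact absurd l.1 hdne
        · exact l.2.symm
      refine condOne_of_zpow_eq (div_ne_zero hc0 hd0) (fun h => hcd ((div_eq_one_iff_eq hd0).1 h)) hn
        (by rw [div_zpow, hc, hd, div_one]) (fun a ha b hb => ?_)
        fun a ha b hb => (key a ha).trans (key b hb).symm
      rw [div_zpow, div_zpow, hcB a ha b hb, hdB a ha b hb]
  · right
    push Not at hcol
    obtain ⟨k₁, hk₁, -, hdvd₁⟩ := exists_order_of_zpow_eq_one hc0 hn hc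
    obtain ⟨k₂, hk₂, -, hdvd₂⟩ := exists_order_of_zpow_eq_one hd0 hn hd
    have hlcm : ∀ m : ℤ, ((Nat.lcm k₁ k₂ : ℕ) : ℤ) ∣ m ↔ c ^ m = 1 ∧ d ^ m = 1 := by
      intro m
      rw [hdvd₁, hdvd₂, Int.natCast_dvd, Int.natCast_dvd, Int.natCast_dvd, Nat.lcm_dvd_iff]
    have shift : ∀ B : Finset ℤ, (∀ a ∈ B, ∀ b ∈ B, c ^ a = c ^ b ∧ d ^ a = d ^ b) →
        ShiftsTo (Nat.lcm k₁ k₂) B := by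
      intro B h
      rcases B.eq_empty_or_nonempty with rfl | ⟨m, hm⟩
      · exact ⟨0, by simp⟩
      · refine ⟨-m, fun b hb => ?_⟩
        obtain ⟨e1, e2⟩ := h b hb m hm
        rw [← sub_eq_add_neg, hlcm, zpow_sub₀ hc0, zpow_sub₀ hd0, e1, e2, div_self (hA m),
          div_self (hD m)]
        exact ⟨rfl, rfl⟩
    -- A modulus 1 or 2 would force `c = d = -1`.
    have hk3 : 3 ≤ Nat.lcm k₁ k₂ := by
      have hpos : 0 < Nat.lcm k₁ k₂ := Nat.lcm_pos hk₁ hk₂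
      by_contra hlt
      have h2 : ((Nat.lcm k₁ k₂ : ℕ) : ℤ) ∣ 2 := by
        have : Nat.lcm k₁ k₂ ∣ 2 := by
          have : Nat.lcm k₁ k₂ = 1 ∨ Nat.lcm k₁ k₂ = 2 := by omega
          rcases this with h | h <;> simp [h]
        exact_mod_cast this
      obtain ⟨e1, e2⟩ := (hlcm 2).1 h2
      have f1 := (mul_self_eq_one_iff.1 (by rw [← pow_two]; exact_mod_cast e1 : c * c = 1)).resolve_left hc1
      have f2 := (mul_self_eq_one_iff.1 (by rw [← pow_two]; exact_mod_cast e2 : d * d = 1)).resolve_left hd1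
      exact hcd (f1.trans f2.symm)
    have h₁ := shift B₁ fun a ha b hb => ⟨hcB a ha b hb, hdB a ha b hb⟩
    rcases B₂.eq_empty_or_nonempty with rfl | ⟨m, hm⟩
    · exact ⟨∅, ∅, _, by simp, by simp, hk3, shift ∅ (by simp), shift ∅ (by simp), h₁⟩
    refine ⟨B₂.filter fun b => c ^ m = c ^ b ∧ d ^ m = d ^ b,
      B₂.filter fun b => ¬ (c ^ m = c ^ b ∧ d ^ m = d ^ b), _,
      Finset.disjoint_filter_filter_not _ _ _, Finset.filter_union_filter_not_eq _ _, hk3,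
      shift _ ?_, shift _ ?_, h₁⟩
    · intro a ha b hb
      rw [Finset.mem_filter] at ha hb
      exact ⟨ha.2.1.symm.trans hb.2.1, ha.2.2.symm.trans hb.2.2⟩
    · intro a ha b hb
      rw [Finset.mem_filter] at ha hb
      obtain ⟨n1, n2, n3⟩ := hcol m hm a ha.1 (by tauto)
      rcases line m hm a ha.1 b hb.1 with l | l | l | l | l | l
      · exact absurd l ha.2
      · exact absurd l hb.2
      · exact l
      · exact absurd l.1 n1
      · exact absurd l.1 n2
      · exact absurd l.1 n3

/-- For `m < s < t` in `B`, the relation makes `c ^ s` a proper convex combination of `c ^ m` and `c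
^ t`. All three lie on the unit circle, so strict convexity makes them equal; the proof does this
algebraically, by conjugation. -/
theorem zpow_eq_of_collinear {B : Finset ℤ} {c : ℂ} {n : ℤ} (hn : n ≠ 0) (hc : c ^ n = 1)
    (hB : ∀ a ∈ B, ∀ b ∈ B, ∀ e ∈ B,
      ((e : ℂ) - b) * c ^ a + ((a : ℂ) - e) * c ^ b + ((b : ℂ) - a) * c ^ e = 0)
    (hcard : 3 ≤ B.card) : ∀ a ∈ B, ∀ b ∈ B, c ^ a = c ^ b := by
  have hc0 : c ≠ 0 := by rintro rfl; rw [zero_zpow _ hn] at hc; exact zero_ne_one hc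
  obtain ⟨m, hm, s, hs, hms, -, -, t, ht, hst⟩ := exists_three_least hcard
  have conj : ∀ b : ℤ, starRingEnd ℂ (c ^ b) = (c ^ b)⁻¹ := by
    intro b
    rw [map_zpow₀, conj_eq_inv_of_zpow_eq_one hn hc, inv_zpow]
  have E := hB m hm s hs t ht
  have E' := congrArg (starRingEnd ℂ) E
  simp only [map_add, map_mul, map_sub, conj, map_intCast, map_zero] at E'
  have hA : ∀ b : ℤ, c ^ b ≠ 0 := fun b => zpow_ne_zero b hc0
  have e1 : ((t : ℂ) - s) ≠ 0 := sub_ne_zero.2 (by exact_mod_cast hst.ne')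
  have e2 : ((s : ℂ) - m) ≠ 0 := sub_ne_zero.2 (by exact_mod_cast hms.ne')
  have e3 : ((t : ℂ) - m) ≠ 0 := sub_ne_zero.2 (by exact_mod_cast (hms.trans hst).ne')
  have hmt : c ^ m = c ^ t := by
    have hm0 := hA m
    have hs0 := hA s
    have ht0 := hA t
    generalize c ^ m = A at *
    generalize c ^ s = S at *
    generalize c ^ t = T at *
    have E1 : ((t : ℂ) - s) * A + ((s : ℂ) - m) * T = ((t : ℂ) - m) * S := by linear_combination E
    have E2 : (((t : ℂ) - s) * T + ((s : ℂ) - m) * A) * S = ((t : ℂ) - m) * (A * T) := by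
      field_simp at E'
      linear_combination E'
    have E3 : ((t : ℂ) - s) * ((s : ℂ) - m) * (A - T) ^ 2 = 0 := by
      have : (((t : ℂ) - s) * A + ((s : ℂ) - m) * T) * (((t : ℂ) - s) * T + ((s : ℂ) - m) * A) =
          ((t : ℂ) - m) ^ 2 * (A * T) := by
        rw [E1]; linear_combination ((t : ℂ) - m) * E2
      linear_combination this
    have := (mul_eq_zero.1 E3).resolve_left (mul_ne_zero e1 e2)
    exact sub_eq_zero.1 (pow_eq_zero_iff (two_ne_zero)|>.1 this)
  have key : ∀ b ∈ B, c ^ b = c ^ m := by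
    intro b hb
    have := hB m hm b hb t ht
    rw [← hmt] at this
    have h2 : ((t : ℂ) - m) * (c ^ b - c ^ m) = 0 := by linear_combination -this
    exact sub_eq_zero.1 ((mul_eq_zero.1 h2).resolve_left e3)
  exact fun a ha b hb => (key a ha).trans (key b hb).symm

/-! ### Multiplicities in terms of coefficients -/

section Orders

variable {B : Finset ℤ}

theorem lowest_mem (hB : B.Nonempty) : lowest B ∈ B ∧ ∀ b ∈ B, lowest B ≤ b := by
  have h : lowest B = B.min' hB := by
    unfold lowest; rw [← Finset.coe_min' hB]; rfl
  rw [h]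
  exact ⟨B.min'_mem hB, fun b hb => B.min'_le b hb⟩

theorem highest_mem (hB : B.Nonempty) : highest B ∈ B ∧ ∀ b ∈ B, b ≤ highest B := by
  have h : highest B = B.max' hB := by
    unfold highest; rw [← Finset.coe_max' hB]; rfl
  rw [h]
  exact ⟨B.max'_mem hB, fun b hb => B.le_max' b hb⟩

theorem lowest_le (b : B) : lowest B ≤ b := (lowest_mem ⟨b, b.2⟩).2 b b.2

theorem le_highest (b : B) : (b : ℤ) ≤ highest B := (highest_mem ⟨b, b.2⟩).2 b b.2

theorem coeff_chartZero (f : B → ℂ) (b : B) :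
    (chartZero f).coeff ((b : ℤ) - lowest B).toNat = f b := by
  unfold chartZero
  rw [Polynomial.finsetSum_coeff, Finset.sum_eq_single b]
  · simp
  · intro c _ hcb
    rw [Polynomial.coeff_C_mul_X_pow, if_neg]
    intro h
    have h1 := lowest_le b
    have h2 := lowest_le c
    exact hcb (Subtype.ext (by omega))
  · simp

theorem coeff_chartInfty (f : B → ℂ) (b : B) :
    (chartInfty f).coeff (highest B - (b : ℤ)).toNat = f b := by
  unfold chartInfty
  rw [Polynomial.finsetSum_coeff, Finset.sum_eq_single b]
  · simp
  · intro c _ hcb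
    rw [Polynomial.coeff_C_mul_X_pow, if_neg]
    intro h
    have h1 := le_highest b
    have h2 := le_highest c
    exact hcb (Subtype.ext (by omega))
  · simp

theorem apply_lowest_eq_zero {f : B → ℂ} (h : 1 ≤ ordAt f 0) {b : B} (hb : (b : ℤ) = lowest B) :
    f b = 0 := by
  have h1 : (Polynomial.X - Polynomial.C 0 : Polynomial ℂ) ^ 1 ∣ chartZero f :=
    pow_dvd_of_le_emultiplicity (by exact_mod_cast h)
  rw [Polynomial.C_0, sub_zero, pow_one, Polynomial.X_dvd_iff] at h1
  rw [← coeff_chartZero f b, hb, sub_self]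
  exact h1

theorem apply_highest_eq_zero {f : B → ℂ} (h : 1 ≤ ordInfty f) {b : B}
    (hb : (b : ℤ) = highest B) : f b = 0 := by
  have h1 : (Polynomial.X : Polynomial ℂ) ^ 1 ∣ chartInfty f :=
    pow_dvd_of_le_emultiplicity (by exact_mod_cast h)
  rw [pow_one, Polynomial.X_dvd_iff] at h1
  rw [← coeff_chartInfty f b, hb, sub_self]
  exact h1

theorem zpow_lowest_mul_pow {x : ℂ} (hx : x ≠ 0) (b : B) :
    x ^ lowest B * x ^ ((b : ℤ) - lowest B).toNat = x ^ (b : ℤ) := by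
  rw [← zpow_natCast, Int.toNat_of_nonneg (sub_nonneg.2 (lowest_le b)), ← zpow_add₀ hx]
  congr 1; ring

theorem laurentEval_eq {f : B → ℂ} {x : ℂ} (hx : x ≠ 0) :
    laurentEval f x = x ^ lowest B * (chartZero f).eval x := by
  unfold laurentEval chartZero
  rw [Polynomial.eval_finsetSum, Finset.mul_sum]
  refine Finset.sum_congr rfl fun b _ => ?_
  rw [← zpow_lowest_mul_pow hx b]
  simp; ring

theorem sum_deriv_eq_zero {f : B → ℂ} {x : ℂ} (hx : x ≠ 0) (h0 : laurentEval f x = 0)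
    (h : 2 ≤ ordAt f x) : ∑ b : B, ((b : ℤ) : ℂ) * x ^ (b : ℤ) * f b = 0 := by
  have h1 : (Polynomial.X - Polynomial.C x : Polynomial ℂ) ^ 2 ∣ chartZero f :=
    pow_dvd_of_le_emultiplicity (by exact_mod_cast h)
  obtain ⟨q, hq⟩ := h1
  have h2 : (chartZero f).derivative.eval x = 0 := by
    rw [hq, pow_two, Polynomial.derivative_mul, Polynomial.derivative_mul]; simp
  unfold chartZero at h2
  rw [Polynomial.derivative_sum, Polynomial.eval_finsetSum] at h2
  have h3 : ∑ b : B, (((b : ℤ) : ℂ) - (lowest B : ℂ)) * x ^ (b : ℤ) * f b = 0 := by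
    rw [← mul_zero (x ^ lowest B * x), ← h2, Finset.mul_sum]
    refine Finset.sum_congr rfl fun b _ => ?_
    rw [← zpow_lowest_mul_pow hx b]
    have hn : (((b : ℤ) : ℂ) - (lowest B : ℂ)) = (((b : ℤ) - lowest B).toNat : ℂ) := by
      have := Int.toNat_of_nonneg (sub_nonneg.2 (lowest_le b))
      rw [← Int.cast_sub, ← Int.cast_natCast (R := ℂ), this]
    rw [hn, Polynomial.derivative_C_mul_X_pow]
    generalize ((b : ℤ) - lowest B).toNat = n
    rcases n with _ | n
    · simp
    · simp only [add_tsub_cancel_right, Polynomial.eval_mul, Polynomial.eval_C,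
        Polynomial.eval_pow, Polynomial.eval_X]
      ring
  -- Differentiating the chart gives weights `b - lowest B`; the shift only adds a multiple of `f(x)
  -- = 0`.
  have h4 : ∑ b : B, ((b : ℤ) : ℂ) * x ^ (b : ℤ) * f b =
      ∑ b : B, (((b : ℤ) : ℂ) - (lowest B : ℂ)) * x ^ (b : ℤ) * f b +
        (lowest B : ℂ) * laurentEval f x := by
    unfold laurentEval
    rw [Finset.mul_sum, ← Finset.sum_add_distrib]
    refine Finset.sum_congr rfl fun b _ => ?_
    ring
  rw [h4, h3, h0, mul_zero, add_zero]

theorem eq_zero_of_three_roots {f : B → ℂ} (hB : ∀ b ∈ B, ∀ b' ∈ B, b - b' ≤ 2) {x : Fin 3 → ℂ}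
    (hx : Function.Injective x) (hx0 : ∀ j, x j ≠ 0) (hf : ∀ j, laurentEval f (x j) = 0) :
    f = 0 := by
  have h0 : chartZero f = 0 := by
    apply Polynomial.eq_zero_of_natDegree_lt_card_of_eval_eq_zero _ hx
    · intro j
      have := hf j
      rw [laurentEval_eq (hx0 j)] at this
      exact (mul_eq_zero.1 this).resolve_left (zpow_ne_zero _ (hx0 j))
    · rw [Fintype.card_fin]
      refine Nat.lt_succ_of_le (Polynomial.natDegree_sum_le_of_forall_le _ _ fun b _ => ?_)
      refine (Polynomial.natDegree_C_mul_X_pow_le _ _).trans ?_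
      have := hB b b.2 (lowest B) (lowest_mem ⟨b, b.2⟩).1
      omega
  ext b
  rw [← coeff_chartZero f b, h0]; rfl

end Orders

/-! ### Ranks of families of monomial rows -/

section Ranks

variable {K : Type} [Field K] {B : Finset ℤ}

/-- The row of values of the monomials with exponents in `B` at `x`. -/
def monomialRow (B : Finset ℤ) (x : K) : B → K := fun b => x ^ (b : ℤ)

/-- The row of values of the logarithmic derivatives of the monomials with exponents in `B`. -/
def derivRow (B : Finset ℤ) (x : K) : B → K := fun b => ((b : ℤ) : K) * x ^ (b : ℤ)

theorem one_le_finrank_of_ne_zero (W : Submodule K (B → K)) {p : B → K} (hp : p ∈ W) {b : ℤ}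
    (hb : b ∈ B) (h : p ⟨b, hb⟩ ≠ 0) : 1 ≤ Module.finrank K W :=
  le_finrank_of_det_ne_zero W (fun _ : Fin 1 => p) (fun _ => hp) (fun _ => ⟨b, hb⟩) (by simpa)

theorem two_le_finrank_of_ne_zero (W : Submodule K (B → K)) {p q : B → K} (hp : p ∈ W)
    (hq : q ∈ W) {a b : ℤ} (ha : a ∈ B) (hb : b ∈ B)
    (h : p ⟨a, ha⟩ * q ⟨b, hb⟩ - p ⟨b, hb⟩ * q ⟨a, ha⟩ ≠ 0) : 2 ≤ Module.finrank K W := by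
  refine le_finrank_of_det_ne_zero W ![p, q] (fun i => ?_) ![⟨a, ha⟩, ⟨b, hb⟩] ?_
  · fin_cases i <;> assumption
  · rw [Matrix.det_fin_two]
    simpa using h

theorem three_le_finrank_of_ne_zero (W : Submodule K (B → K)) {p q r : B → K} (hp : p ∈ W)
    (hq : q ∈ W) (hr : r ∈ W) {a b c : ℤ} (ha : a ∈ B) (hb : b ∈ B) (hc : c ∈ B)
    (h : p ⟨a, ha⟩ * (q ⟨b, hb⟩ * r ⟨c, hc⟩ - q ⟨c, hc⟩ * r ⟨b, hb⟩) -
      p ⟨b, hb⟩ * (q ⟨a, ha⟩ * r ⟨c, hc⟩ - q ⟨c, hc⟩ * r ⟨a, ha⟩) +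
      p ⟨c, hc⟩ * (q ⟨a, ha⟩ * r ⟨b, hb⟩ - q ⟨b, hb⟩ * r ⟨a, ha⟩) ≠ 0) :
    3 ≤ Module.finrank K W := by
  refine le_finrank_of_det_ne_zero W ![p, q, r] (fun i => ?_) ![⟨a, ha⟩, ⟨b, hb⟩, ⟨c, hc⟩] ?_
  · fin_cases i <;> assumption
  · rw [Matrix.det_fin_three]
    simp only [Matrix.of_apply, Matrix.cons_val]
    intro h0
    exact h (by rw [← h0]; ring)

theorem one_le_finrank_of_monomialRow (W : Submodule K (B → K)) (hB : 2 ≤ B.card) {x : K}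
    (hx : x ≠ 0) (hW : monomialRow B x ∈ W) : 1 ≤ Module.finrank K W := by
  obtain ⟨b, hb⟩ : B.Nonempty := Finset.card_pos.1 (by omega)
  exact one_le_finrank_of_ne_zero W hW hb (zpow_ne_zero _ hx)

theorem two_le_finrank_of_not_proportional (W : Submodule K (B → K)) {x y : K}
    (hx : monomialRow B x ∈ W) (hy : monomialRow B y ∈ W) (h : ¬ RowsProportional B x y) :
    2 ≤ Module.finrank K W := by
  unfold RowsProportional at h
  push Not at h
  obtain ⟨a, ha, b, hb, h⟩ := h
  exact two_le_finrank_of_ne_zero W hx hy ha hb (sub_ne_zero.2 h)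

theorem three_le_finrank_of_not_minorsVanish (W : Submodule K (B → K)) {x y z : K}
    (hx : monomialRow B x ∈ W) (hy : monomialRow B y ∈ W) (hz : monomialRow B z ∈ W)
    (h : ¬ MinorsVanish B x y z) : 3 ≤ Module.finrank K W := by
  unfold MinorsVanish at h
  push Not at h
  obtain ⟨a, ha, b, hb, c, hc, h⟩ := h
  exact three_le_finrank_of_ne_zero W hx hy hz ha hb hc h

theorem two_le_finrank_of_derivRow [CharZero K] (W : Submodule K (B → K)) (hB : 2 ≤ B.card)
    {x : K} (hx : x ≠ 0) (h : monomialRow B x ∈ W) (h' : derivRow B x ∈ W) :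
    2 ≤ Module.finrank K W := by
  obtain ⟨a, ha, b, hb, hab⟩ := Finset.one_lt_card.1 hB
  refine two_le_finrank_of_ne_zero W h h' ha hb ?_
  have : monomialRow B x ⟨a, ha⟩ * derivRow B x ⟨b, hb⟩ -
      monomialRow B x ⟨b, hb⟩ * derivRow B x ⟨a, ha⟩ = ((b : K) - a) * (x ^ a * x ^ b) := by
    simp only [monomialRow, derivRow]; ring
  rw [this]
  exact mul_ne_zero (sub_ne_zero.2 (by exact_mod_cast hab.symm))
    (mul_ne_zero (zpow_ne_zero _ hx) (zpow_ne_zero _ hx))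

theorem two_le_finrank_of_single (W : Submodule K (B → K)) (hB : 2 ≤ B.card) {x : K} (hx : x ≠ 0)
    {e : B} (h : monomialRow B x ∈ W) (h' : Pi.single e 1 ∈ W) : 2 ≤ Module.finrank K W := by
  obtain ⟨b, hb, hbe⟩ := Finset.exists_mem_ne (by omega : 1 < B.card) (e : ℤ)
  refine two_le_finrank_of_ne_zero W h' h e.2 hb ?_
  have h1 : (⟨b, hb⟩ : B) ≠ e := fun h => hbe (congrArg Subtype.val h)
  simpa [h1, monomialRow] using zpow_ne_zero b hx

end Ranks

/-! ### Transcendence degrees of fields generated by roots -/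

section Generated

variable {K : Type} [Field K] [Algebra ℂ K]

theorem trdeg_le_one_of_ratio {k : ℕ} {X : Fin k → K}
    (hX : IntermediateField.adjoin ℂ (Set.range X) = ⊤) {z : K} (hz : z ≠ 0)
    (h : ∀ j, ∃ c : ℂ, algebraMap ℂ K c = X j / z) : Algebra.trdeg ℂ K ≤ (1 : ℕ) := by
  apply trdeg_le_of_adjoin_eq_top (fun _ : Fin 1 => z)
  rw [eq_top_iff, ← hX, IntermediateField.adjoin_le_iff]
  rintro _ ⟨j, rfl⟩
  obtain ⟨c, hc⟩ := h j
  rw [eq_div_iff hz] at hc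
  rw [← hc]
  exact mul_mem (IntermediateField.algebraMap_mem _ c)
    (IntermediateField.subset_adjoin ℂ _ ⟨0, rfl⟩)

/-- After removal of a monomial factor, a minor with distinct columns is a nonzero polynomial in the
three roots. -/
theorem not_algebraicIndependent_of_minorsVanish {B : Finset ℤ} (hB : 3 ≤ B.card) {X : Fin 3 → K}
    (hX0 : ∀ j, X j ≠ 0) (h : MinorsVanish B (X 0) (X 1) (X 2)) : ¬ AlgebraicIndependent ℂ X := by
  intro hind
  obtain ⟨m, hm, s, hs, hms, -, -, c, hc, hsc⟩ := exists_three_least hB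
  obtain ⟨p, hp⟩ : ∃ p : ℕ, s - m = p := ⟨(s - m).toNat, by omega⟩
  obtain ⟨q, hq⟩ : ∃ q : ℕ, c - m = q := ⟨(c - m).toNat, by omega⟩
  have hs' : s = m + p := by omega
  have hc' : c = m + q := by omega
  have hp0 : 0 < p := by omega
  have hpq : p < q := by omega
  have E := h m hm s hs c hc
  unfold monomialMinor at E
  rw [hs', hc'] at E
  simp only [zpow_add₀ (hX0 _), zpow_natCast] at E
  let x : Fin 3 → MvPolynomial (Fin 3) ℂ := MvPolynomial.X
  let P : MvPolynomial (Fin 3) ℂ := (x 1 ^ p * x 2 ^ q - x 1 ^ q * x 2 ^ p) -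
    x 0 ^ p * (x 2 ^ q - x 1 ^ q) + x 0 ^ q * (x 2 ^ p - x 1 ^ p)
  have hP : MvPolynomial.aeval X P = 0 := by
    have hm0 : X 0 ^ m * X 1 ^ m * X 2 ^ m ≠ 0 :=
      mul_ne_zero (mul_ne_zero (zpow_ne_zero _ (hX0 0)) (zpow_ne_zero _ (hX0 1)))
        (zpow_ne_zero _ (hX0 2))
    apply (mul_eq_zero.1 (?_ : X 0 ^ m * X 1 ^ m * X 2 ^ m * _ = 0)).resolve_left hm0
    simp only [P, x, map_add, map_sub, map_mul, map_pow, MvPolynomial.aeval_X]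
    linear_combination E
  have hP0 := hind.eq_zero_of_aeval_eq_zero P hP
  -- At `(1, 2, 4)` the minor is the Vandermonde determinant of `1, 2 ^ p, 2 ^ q`.
  have hev := congrArg (MvPolynomial.eval ![(1 : ℂ), 2, 4]) hP0
  simp only [P, x, map_add, map_sub, map_mul, map_pow, MvPolynomial.eval_X, map_zero,
    Matrix.cons_val, one_pow] at hev
  have h4 : ∀ n : ℕ, (4 : ℂ) ^ n = 2 ^ n * 2 ^ n := fun n => by
    rw [← mul_pow]; norm_num
  rw [h4, h4] at hev
  have hfac : ((2 : ℂ) ^ q - 2 ^ p) * (2 ^ p - 1) * (2 ^ q - 1) = 0 := by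
    linear_combination hev
  have hinj : ∀ a b : ℕ, a < b → (2 : ℂ) ^ b - 2 ^ a ≠ 0 := by
    intro a b hab h
    have h1 : (2 : ℂ) ^ b = 2 ^ a := sub_eq_zero.1 h
    have h2 : 2 ^ b = 2 ^ a := by exact_mod_cast h1
    exact hab.ne' (Nat.pow_right_injective le_rfl h2)
  refine mul_ne_zero (mul_ne_zero (hinj p q hpq) ?_) ?_ hfac
  · simpa using hinj 0 p hp0
  · simpa using hinj 0 q (hp0.trans hpq)

/-- Up to a power of `u`, the relation is a polynomial equation with constant term `q - p ≠ 0`, so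
`u` is algebraic over `ℂ`. -/
theorem ratio_mem_range_of_confluent {B : Finset ℤ} (hB : 3 ≤ B.card) {u : K}
    (h : ∀ a ∈ B, ∀ b ∈ B, ∀ e ∈ B,
      ((e : K) - b) * u ^ a + ((a : K) - e) * u ^ b + ((b : K) - a) * u ^ e = 0) (hu : u ≠ 0) :
    ∃ c : ℂ, algebraMap ℂ K c = u := by
  obtain ⟨m, hm, s, hs, hms, -, -, c, hc, hsc⟩ := exists_three_least hB
  obtain ⟨p, hp⟩ : ∃ p : ℕ, s - m = p := ⟨(s - m).toNat, by omega⟩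
  obtain ⟨q, hq⟩ : ∃ q : ℕ, c - m = q := ⟨(c - m).toNat, by omega⟩
  have E := h m hm s hs c hc
  rw [show s = m + p by omega, show c = m + q by omega] at E
  simp only [zpow_add₀ hu, zpow_natCast] at E
  apply mem_range_algebraMap_of_isAlgebraic
  refine ⟨Polynomial.C ((q : ℂ) - p) - Polynomial.C (q : ℂ) * Polynomial.X ^ p +
    Polynomial.C (p : ℂ) * Polynomial.X ^ q, ?_, ?_⟩
  · intro h0
    have h1 := congrArg (fun P => Polynomial.coeff P 0) h0
    have hp0 : p ≠ 0 := by omega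
    have hq0 : q ≠ 0 := by omega
    simp [Polynomial.coeff_X_pow, hp0.symm, hq0.symm, sub_eq_zero] at h1
    omega
  · apply mul_left_cancel₀ (zpow_ne_zero m hu)
    push_cast at E
    simp only [map_add, map_sub, map_mul, map_pow, Polynomial.aeval_X, map_natCast]
    linear_combination E

end Generated

/-! ### Relations satisfied by a generic pair. -/

theorem codimAtLeast_of_irreducible {σ : Type} {c : ℕ} {N : Set (σ → ℂ)}
    (h : ∀ Y ⊆ N, @IsIrreducible _ (zariski σ) Y → (c : ℕ∞) ≤ codim Y) : CodimAtLeast c N :=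
  fun Z hZ => h Z hZ.prop.1 hZ.prop.2

theorem symmetricFiltration_eq (j₀ jInf : ℕ) {k : ℕ} (j : Fin k → ℕ) :
    symmetricFiltration B₁ B₂ j₀ jInf j = generalFiltration B₁ B₂ j₀ jInf j j := by
  ext F
  simp only [symmetricFiltration, generalFiltration, pairOrdAt, Set.mem_ofPred_eq, le_min_iff]

/-- Linear relations between the coefficients of a generic pair, over the field generated by its
common roots. -/
theorem exists_generic_relations {Y : Set (PairSpace B₁ B₂)} (hB₁ : B₁.Nonempty)
    (hB₂ : B₂.Nonempty) (hY : @IsIrreducible _ (zariski (B₁ ⊕ B₂)) Y) {j₀ jInf k : ℕ}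
    {p q : Fin k → ℕ} (hYN : Y ⊆ generalFiltration B₁ B₂ j₀ jInf p q) :
    ∃ (K : Type) (_ : Field K) (_ : Algebra ℂ K) (X : Fin k → K) (W₁ : Submodule K (B₁ → K))
      (W₂ : Submodule K (B₂ → K)), (∀ j, X j ≠ 0) ∧ Function.Injective X ∧
      IntermediateField.adjoin ℂ (Set.range X) = ⊤ ∧
      (∀ j, monomialRow B₁ (X j) ∈ W₁) ∧ (∀ j, monomialRow B₂ (X j) ∈ W₂) ∧
      (∀ j, 2 ≤ p j → derivRow B₁ (X j) ∈ W₁) ∧ (∀ j, 2 ≤ q j → derivRow B₂ (X j) ∈ W₂) ∧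
      (1 ≤ j₀ → (∃ e, Pi.single e 1 ∈ W₁) ∧ ∃ e, Pi.single e 1 ∈ W₂) ∧
      (1 ≤ jInf → (∃ e, Pi.single e 1 ∈ W₁) ∧ ∃ e, Pi.single e 1 ∈ W₂) ∧
      W₁ ≠ ⊤ ∧ W₂ ≠ ⊤ ∧
      ∀ r₁ r₂ t c : ℕ, r₁ ≤ Module.finrank K W₁ → r₂ ≤ Module.finrank K W₂ →
        Algebra.trdeg ℂ K ≤ t → c + t ≤ r₁ + r₂ → (c : ℕ∞) ≤ codim Y := by
  classical
  choose hf₁ hf₂ h0 hInf x hinj hx0 hroot hord using hYN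
  obtain ⟨L, _, _, φ, K, X, hφ, ⟨b₁, hb₁⟩, ⟨b₂, hb₂⟩, hX0, hXinj, hXtop, hXφ⟩ :=
    exists_generic_pair hY (fun F hF => hf₁ hF) (fun F hF => hf₂ hF) (fun y => x y.2)
      (fun y j => hx0 y.2 j) (fun y => hinj y.2)
  let ker : ∀ {B : Finset ℤ}, (B → Y → ℂ) → Submodule K (B → K) := fun {B} f =>
    LinearMap.ker (Fintype.linearCombination K fun b => φ (f b))
  have mem_ker : ∀ {B : Finset ℤ} (f : B → Y → ℂ) (w : B → K),
      w ∈ ker f ↔ ∑ b, (w b : L) * φ (f b) = 0 := by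
    intro B f w
    simp only [ker, LinearMap.mem_ker, Fintype.linearCombination_apply, Algebra.smul_def]
    rfl
  -- The weights `n b = 1` express a root, and `n b = b` a double root.
  have row : ∀ {B : Finset ℤ} (f : B → Y → ℂ) (n : B → ℤ) (j : Fin k),
      (∀ y, ∑ b, (n b : ℂ) * x y.2 j ^ (b : ℤ) * f b y = 0) →
      (fun b => (n b : K) * X j ^ (b : ℤ)) ∈ ker f := by
    intro B f n j h
    rw [mem_ker]
    have h1 : ∑ b, (n b : Y → ℂ) * (fun y : Y => x y.2 j ^ (b : ℤ)) * f b = 0 := by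
      ext y
      simpa using h y
    have h2 := congrArg φ h1
    rw [map_sum, map_zero] at h2
    rw [← h2]
    refine Finset.sum_congr rfl fun b _ => ?_
    rw [map_mul, map_mul, hXφ, map_intCast]
    push_cast
    rfl
  have single : ∀ {B : Finset ℤ} (f : B → Y → ℂ) (e : B), (∀ y, f e y = 0) →
      Pi.single e 1 ∈ ker f := by
    intro B f e h
    rw [mem_ker, Finset.sum_eq_single e]
    · rw [show f e = 0 from funext h, map_zero, mul_zero]
    · intro b _ hb; simp [hb]
    · simp
  have ne_top : ∀ {B : Finset ℤ} (f : B → Y → ℂ) (e : B), φ (f e) ≠ 0 → ker f ≠ ⊤ := by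
    intro B f e h htop
    have : Pi.single e 1 ∈ ker f := by rw [htop]; trivial
    rw [mem_ker, Finset.sum_eq_single e] at this
    · exact h (by simpa using this)
    · intro b _ hb; simp [hb]
    · simp
  let f₁ : B₁ → Y → ℂ := fun b y => y.1 (Sum.inl b)
  let f₂ : B₂ → Y → ℂ := fun b y => y.1 (Sum.inr b)
  refine ⟨K, inferInstance, inferInstance, X, ker f₁, ker f₂, hX0, hXinj, hXtop, ?_, ?_, ?_, ?_,
    ?_, ?_, ne_top f₁ b₁ hb₁, ne_top f₂ b₂ hb₂, ?_⟩
  · intro j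
    convert row f₁ (fun _ => 1) j fun y => ?_ using 1
    · ext b; simp [monomialRow]
    · rw [← (hroot y.2 j).1]
      exact Finset.sum_congr rfl fun b _ => by simp [f₁, PairSpace.fst, mul_comm]
  · intro j
    convert row f₂ (fun _ => 1) j fun y => ?_ using 1
    · ext b; simp [monomialRow]
    · rw [← (hroot y.2 j).2]
      exact Finset.sum_congr rfl fun b _ => by simp [f₂, PairSpace.snd, mul_comm]
  · intro j hj
    exact row f₁ (fun b => b) j fun y => sum_deriv_eq_zero (hx0 y.2 j) (hroot y.2 j).1
      (le_trans (by exact_mod_cast hj) (hord y.2 j).1)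
  · intro j hj
    exact row f₂ (fun b => b) j fun y => sum_deriv_eq_zero (hx0 y.2 j) (hroot y.2 j).2
      (le_trans (by exact_mod_cast hj) (hord y.2 j).2)
  · intro hj
    have h1 : ∀ y : Y, 1 ≤ pairOrdAt y.1 0 := fun y => le_trans (by exact_mod_cast hj) (h0 y.2)
    exact ⟨⟨⟨lowest B₁, (lowest_mem hB₁).1⟩, single f₁ _ fun y =>
        apply_lowest_eq_zero ((le_min_iff.1 (h1 y)).1) rfl⟩,
      ⟨⟨lowest B₂, (lowest_mem hB₂).1⟩, single f₂ _ fun y =>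
        apply_lowest_eq_zero ((le_min_iff.1 (h1 y)).2) rfl⟩⟩
  · intro hj
    have h1 : ∀ y : Y, 1 ≤ pairOrdInfty y.1 := fun y => le_trans (by exact_mod_cast hj) (hInf y.2)
    exact ⟨⟨⟨highest B₁, (highest_mem hB₁).1⟩, single f₁ _ fun y =>
        apply_highest_eq_zero ((le_min_iff.1 (h1 y)).1) rfl⟩,
      ⟨⟨highest B₂, (highest_mem hB₂).1⟩, single f₂ _ fun y =>
        apply_highest_eq_zero ((le_min_iff.1 (h1 y)).2) rfl⟩⟩
  · intro r₁ r₂ t c hr₁ hr₂ ht hc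
    exact le_codim_of_relations φ hφ K (ker f₁) (ker f₂) (fun w hw => (mem_ker f₁ w).1 hw)
      (fun w hw => (mem_ker f₂ w).1 hw) hr₁ hr₂ ht hc

theorem CondOne.symm (h : CondOne B₁ B₂) : CondOne B₂ B₁ := by
  obtain ⟨k, hk, h₁, h₂⟩ := h
  exact ⟨k, hk, h₂, h₁⟩

/-! ### Ranks against transcendence degree. -/

section Bounds

variable {K : Type} [Field K]

theorem finrank_lt_card_of_ne_top {B : Finset ℤ} {W : Submodule K (B → K)} (h : W ≠ ⊤) :
    Module.finrank K W < B.card := by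
  have := Submodule.finrank_lt h
  rwa [Module.finrank_fintype_fun_eq_card, Fintype.card_coe] at this

theorem RowsProportional.zpow_eq {B : Finset ℤ} {x y : K} (hx : x ≠ 0)
    (hy : y ≠ 0) (h : RowsProportional B x y) : ∀ a ∈ B, ∀ b ∈ B, (x / y) ^ a = (x / y) ^ b := by
  intro a ha b hb
  have := (rowsProportional_iff hx hy).1 h a ha b hb
  rwa [zpow_sub₀ (div_ne_zero hx hy),
    div_eq_one_iff_eq (zpow_ne_zero _ (div_ne_zero hx hy))] at this

theorem condOne_of_rowsProportional (hB₁ : 2 ≤ B₁.card) {x y : K} (hx : x ≠ 0) (hy : y ≠ 0)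
    (hxy : x ≠ y) (h₁ : RowsProportional B₁ x y) (h₂ : RowsProportional B₂ x y) :
    CondOne B₁ B₂ := by
  obtain ⟨d, hd, hd1⟩ := h₁.exists_zpow_eq_one hB₁ hx hy
  exact condOne_of_zpow_eq (div_ne_zero hx hy) (fun h => hxy ((div_eq_one_iff_eq hy).1 h)) hd hd1
    (h₁.zpow_eq hx hy) (h₂.zpow_eq hx hy)

variable [Algebra ℂ K]

theorem RowsProportional.ratio_constant {B : Finset ℤ} (hB : 2 ≤ B.card) {x y : K} (hx : x ≠ 0)
    (hy : y ≠ 0) (h : RowsProportional B x y) : ∃ c : ℂ, algebraMap ℂ K c = x / y := by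
  obtain ⟨d, hd, hd1⟩ := h.exists_zpow_eq_one hB hx hy
  exact mem_range_algebraMap_of_zpow_eq_one hd hd1

theorem trdeg_le_one_of_pair {X : Fin 2 → K}
    (hX : IntermediateField.adjoin ℂ (Set.range X) = ⊤) (hX0 : ∀ j, X j ≠ 0)
    (h : ∃ c : ℂ, algebraMap ℂ K c = X 1 / X 0) : Algebra.trdeg ℂ K ≤ (1 : ℕ) := by
  refine trdeg_le_one_of_ratio hX (hX0 0) fun j => ?_
  fin_cases j
  · exact ⟨1, by simp [hX0 0]⟩
  · exact h

theorem trdeg_le_one_of_triple {X : Fin 3 → K}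
    (hX : IntermediateField.adjoin ℂ (Set.range X) = ⊤) (hX0 : ∀ j, X j ≠ 0)
    (h₀ : ∃ c : ℂ, algebraMap ℂ K c = X 0 / X 2) (h₁ : ∃ c : ℂ, algebraMap ℂ K c = X 1 / X 2) :
    Algebra.trdeg ℂ K ≤ (1 : ℕ) := by
  refine trdeg_le_one_of_ratio hX (hX0 2) fun j => ?_
  fin_cases j
  · exact h₀
  · exact h₁
  · exact ⟨1, by simp [hX0 2]⟩

variable {W₁ : Submodule K (B₁ → K)} {W₂ : Submodule K (B₂ → K)}

theorem exists_bound_two_roots (hB₁ : 2 ≤ B₁.card) (hB₂ : 2 ≤ B₂.card) (hcond : ¬ CondOne B₁ B₂)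
    {X : Fin 2 → K} (hX : IntermediateField.adjoin ℂ (Set.range X) = ⊤) (hX0 : ∀ j, X j ≠ 0)
    (hinj : Function.Injective X) (h₁ : ∀ j, monomialRow B₁ (X j) ∈ W₁)
    (h₂ : ∀ j, monomialRow B₂ (X j) ∈ W₂) :
    ∃ r₁ r₂ t : ℕ, r₁ ≤ Module.finrank K W₁ ∧ r₂ ≤ Module.finrank K W₂ ∧
      Algebra.trdeg ℂ K ≤ t ∧ 2 + t ≤ r₁ + r₂ := by
  by_cases p₁ : RowsProportional B₁ (X 1) (X 0)
  · have p₂ : ¬ RowsProportional B₂ (X 1) (X 0) := fun p₂ =>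
      hcond (condOne_of_rowsProportional hB₁ (hX0 1) (hX0 0) (hinj.ne (by decide)) p₁ p₂)
    exact ⟨1, 2, 1, one_le_finrank_of_monomialRow W₁ hB₁ (hX0 0) (h₁ 0),
      two_le_finrank_of_not_proportional W₂ (h₂ 1) (h₂ 0) p₂,
      trdeg_le_one_of_pair hX hX0 (p₁.ratio_constant hB₁ (hX0 1) (hX0 0)), le_rfl⟩
  by_cases p₂ : RowsProportional B₂ (X 1) (X 0)
  · exact ⟨2, 1, 1, two_le_finrank_of_not_proportional W₁ (h₁ 1) (h₁ 0) p₁,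
      one_le_finrank_of_monomialRow W₂ hB₂ (hX0 0) (h₂ 0),
      trdeg_le_one_of_pair hX hX0 (p₂.ratio_constant hB₂ (hX0 1) (hX0 0)), le_rfl⟩
  · exact ⟨2, 2, 2, two_le_finrank_of_not_proportional W₁ (h₁ 1) (h₁ 0) p₁,
      two_le_finrank_of_not_proportional W₂ (h₂ 1) (h₂ 0) p₂,
      trdeg_le_of_adjoin_eq_top X hX, le_rfl⟩

/-- The value and derivative rows give `W₁` rank 2, so `W₁ ≠ ⊤` forces `B₁` to have three elements.
Either the row at the second root raises the rank to 3, or the ratio of the roots is constant. In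
the second case proportional rows on `B₂` would make it a root of unity, hence also constant in its
powers on `B₁`, which is condition 1. -/
theorem exists_bound_double_root (hB₁ : 2 ≤ B₁.card) (hB₂ : 2 ≤ B₂.card)
    (hcond : ¬ CondOne B₁ B₂)
    {X : Fin 2 → K} (hX : IntermediateField.adjoin ℂ (Set.range X) = ⊤) (hX0 : ∀ j, X j ≠ 0)
    (hinj : Function.Injective X) (h₁ : ∀ j, monomialRow B₁ (X j) ∈ W₁)
    (h₂ : ∀ j, monomialRow B₂ (X j) ∈ W₂) (hd : derivRow B₁ (X 0) ∈ W₁) (htop : W₁ ≠ ⊤) :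
    ∃ r₁ r₂ t : ℕ, r₁ ≤ Module.finrank K W₁ ∧ r₂ ≤ Module.finrank K W₂ ∧
      Algebra.trdeg ℂ K ≤ t ∧ 3 + t ≤ r₁ + r₂ := by
  have hchar : CharZero K := charZero_of_injective_algebraMap (algebraMap ℂ K).injective
  have hr₁ : 2 ≤ Module.finrank K W₁ := two_le_finrank_of_derivRow W₁ hB₁ (hX0 0) (h₁ 0) hd
  have hcard : 3 ≤ B₁.card := by have := finrank_lt_card_of_ne_top htop; omega
  have hu0 : X 1 / X 0 ≠ 0 := div_ne_zero (hX0 1) (hX0 0)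
  by_cases hconf : ∀ a ∈ B₁, ∀ b ∈ B₁, ∀ e ∈ B₁, ((e : K) - b) * (X 1 / X 0) ^ a +
      ((a : K) - e) * (X 1 / X 0) ^ b + ((b : K) - a) * (X 1 / X 0) ^ e = 0
  · obtain ⟨c, hc⟩ := ratio_mem_range_of_confluent hcard hconf hu0
    have ht := trdeg_le_one_of_pair hX hX0 ⟨c, hc⟩
    have p₂ : ¬ RowsProportional B₂ (X 1) (X 0) := by
      intro p₂
      obtain ⟨n, hn, hn1⟩ := p₂.exists_zpow_eq_one hB₂ (hX0 1) (hX0 0)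
      have h2 := p₂.zpow_eq (hX0 1) (hX0 0)
      have hu1 : X 1 / X 0 ≠ 1 := fun h =>
        absurd (hinj ((div_eq_one_iff_eq (hX0 0)).1 h)) (by decide)
      refine hcond (condOne_of_zpow_eq hu0 hu1 hn hn1 (fun a ha b hb => ?_) h2)
      rw [← hc, ← map_zpow₀, ← map_zpow₀]
      congr 1
      refine zpow_eq_of_collinear hn ?_ (fun a ha b hb e he => ?_) hcard a ha b hb
      · apply FaithfulSMul.algebraMap_injective ℂ K
        rw [map_zpow₀, hc, hn1, map_one]
      · apply FaithfulSMul.algebraMap_injective ℂ K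
        simpa [hc] using hconf a ha b hb e he
    exact ⟨2, 2, 1, hr₁, two_le_finrank_of_not_proportional W₂ (h₂ 1) (h₂ 0) p₂, ht, le_rfl⟩
  · have hr₁' : 3 ≤ Module.finrank K W₁ := by
      push Not at hconf
      obtain ⟨a, ha, b, hb, e, he, hne⟩ := hconf
      refine three_le_finrank_of_ne_zero W₁ (h₁ 0) hd (h₁ 1) ha hb he fun h => hne ?_
      have hm0 : X 0 ^ a * X 0 ^ b * X 0 ^ e ≠ 0 := mul_ne_zero
        (mul_ne_zero (zpow_ne_zero _ (hX0 0)) (zpow_ne_zero _ (hX0 0))) (zpow_ne_zero _ (hX0 0))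
      apply mul_left_cancel₀ hm0
      rw [mul_zero, ← h]
      simp only [monomialRow, derivRow, div_zpow]
      have e1 := zpow_ne_zero a (hX0 0)
      have e2 := zpow_ne_zero b (hX0 0)
      have e3 := zpow_ne_zero e (hX0 0)
      field_simp
      ring
    by_cases p₂ : RowsProportional B₂ (X 1) (X 0)
    · exact ⟨3, 1, 1, hr₁', one_le_finrank_of_monomialRow W₂ hB₂ (hX0 0) (h₂ 0),
        trdeg_le_one_of_pair hX hX0 (p₂.ratio_constant hB₂ (hX0 1) (hX0 0)), le_rfl⟩
    · exact ⟨3, 2, 2, hr₁', two_le_finrank_of_not_proportional W₂ (h₂ 1) (h₂ 0) p₂,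
        trdeg_le_of_adjoin_eq_top X hX, le_rfl⟩

theorem condOne_or_splitsAlong_of_minorsVanish (hB₁ : 2 ≤ B₁.card) {X : Fin 3 → K}
    (hX0 : ∀ j, X j ≠ 0) (hinj : Function.Injective X) (p₀ : RowsProportional B₁ (X 0) (X 2))
    (p₁ : RowsProportional B₁ (X 1) (X 2)) (h : MinorsVanish B₂ (X 0) (X 1) (X 2)) :
    CondOne B₁ B₂ ∨ SplitsAlong B₂ B₁ := by
  obtain ⟨a, ha, b, hb, hab⟩ := Finset.one_lt_card.1 hB₁
  have hinjK := FaithfulSMul.algebraMap_injective ℂ K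
  obtain ⟨c, hc⟩ := p₀.ratio_constant hB₁ (hX0 0) (hX0 2)
  obtain ⟨d, hd⟩ := p₁.ratio_constant hB₁ (hX0 1) (hX0 2)
  refine condOne_or_splitsAlong (c := c) (d := d) (n := a - b) (sub_ne_zero.2 hab) ?_ ?_ ?_ ?_ ?_
    ?_ ?_ ?_
  · apply hinjK
    rw [map_zpow₀, hc, map_one]
    exact (rowsProportional_iff (hX0 0) (hX0 2)).1 p₀ a ha b hb
  · apply hinjK
    rw [map_zpow₀, hd, map_one]
    exact (rowsProportional_iff (hX0 1) (hX0 2)).1 p₁ a ha b hb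
  · rintro rfl
    rw [map_one, eq_comm, div_eq_one_iff_eq (hX0 2)] at hc
    exact absurd (hinj hc) (by decide)
  · rintro rfl
    rw [map_one, eq_comm, div_eq_one_iff_eq (hX0 2)] at hd
    exact absurd (hinj hd) (by decide)
  · rintro rfl
    rw [hc, div_left_inj' (hX0 2)] at hd
    exact absurd (hinj hd) (by decide)
  · intro a ha b hb
    apply hinjK
    rw [map_zpow₀, map_zpow₀, hc]
    exact p₀.zpow_eq (hX0 0) (hX0 2) a ha b hb
  · intro a ha b hb
    apply hinjK
    rw [map_zpow₀, map_zpow₀, hd]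
    exact p₁.zpow_eq (hX0 1) (hX0 2) a ha b hb
  · intro a ha b hb e he
    apply hinjK
    simp only [map_mul, map_sub, map_zpow₀, hc, hd]
    have E := h.swap_right.normalized (hX0 0) (hX0 2) (hX0 1) ha hb he
    have hu := div_ne_zero (hX0 0) (hX0 2)
    have hw := div_ne_zero (hX0 1) (hX0 2)
    simp only [zpow_sub₀ hu, zpow_sub₀ hw] at E
    have e1 := zpow_ne_zero a hu
    have e2 := zpow_ne_zero a hw
    generalize X 0 / X 2 = u at *
    generalize X 1 / X 2 = w at *
    field_simp at E
    linear_combination -E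

/-- Independent rows on both supports give `3 + 3 - 3`. If the minors vanish on one support only,
its rank is 2 with degree at most 2, or all its rows are proportional and the degree is at most 1.
If they vanish on both, the ratios are constant and both ranks must be 2. -/
theorem exists_bound_three_roots (hB₁ : 3 ≤ B₁.card) (hB₂ : 3 ≤ B₂.card)
    (hcond : ¬ (CondOne B₁ B₂ ∨ CondTwo B₁ B₂ ∨ CondThree B₁ B₂ ∨ CondFour B₁ B₂))
    (hlen : ¬ ∀ b ∈ B₁, ∀ b' ∈ B₁, b - b' ≤ 2)
    {X : Fin 3 → K} (hX : IntermediateField.adjoin ℂ (Set.range X) = ⊤) (hX0 : ∀ j, X j ≠ 0)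
    (hinj : Function.Injective X) (h₁ : ∀ j, monomialRow B₁ (X j) ∈ W₁)
    (h₂ : ∀ j, monomialRow B₂ (X j) ∈ W₂) :
    ∃ r₁ r₂ t : ℕ, r₁ ≤ Module.finrank K W₁ ∧ r₂ ≤ Module.finrank K W₂ ∧
      Algebra.trdeg ℂ K ≤ t ∧ 3 + t ≤ r₁ + r₂ := by
  have two : ∀ {B : Finset ℤ} {W : Submodule K (B → K)}, (∀ j, monomialRow B (X j) ∈ W) →
      ¬ (RowsProportional B (X 0) (X 2) ∧ RowsProportional B (X 1) (X 2)) →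
      2 ≤ Module.finrank K W := by
    intro B W hW hp
    by_cases p₀ : RowsProportional B (X 0) (X 2)
    · exact two_le_finrank_of_not_proportional W (hW 1) (hW 2) fun p₁ => hp ⟨p₀, p₁⟩
    · exact two_le_finrank_of_not_proportional W (hW 0) (hW 2) p₀
  have deg : ∀ {B : Finset ℤ}, 2 ≤ B.card →
      (RowsProportional B (X 0) (X 2) ∧ RowsProportional B (X 1) (X 2)) →
      Algebra.trdeg ℂ K ≤ (1 : ℕ) := fun hB hp =>
    trdeg_le_one_of_triple hX hX0 (hp.1.ratio_constant hB (hX0 0) (hX0 2))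
      (hp.2.ratio_constant hB (hX0 1) (hX0 2))
  by_cases v₁ : MinorsVanish B₁ (X 0) (X 1) (X 2)
  · by_cases v₂ : MinorsVanish B₂ (X 0) (X 1) (X 2)
    · obtain ⟨c₀, c₁⟩ := ratio_mem_range_of_minorsVanish hB₁ hB₂ (hX0 0) (hX0 1) (hX0 2)
        (hinj.ne (by decide)) (hinj.ne (by decide)) (hinj.ne (by decide)) v₁ v₂ (by tauto)
      refine ⟨2, 2, 1, two h₁ fun hp => ?_, two h₂ fun hp => ?_,
        trdeg_le_one_of_triple hX hX0 c₀ c₁, le_rfl⟩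
      · rcases condOne_or_splitsAlong_of_minorsVanish (by omega) hX0 hinj hp.1 hp.2 v₂ with h | h
        · exact hcond (Or.inl h)
        · exact hcond (Or.inr (Or.inl (Or.inr h)))
      · rcases condOne_or_splitsAlong_of_minorsVanish (by omega) hX0 hinj hp.1 hp.2 v₁ with h | h
        · exact hcond (Or.inl h.symm)
        · exact hcond (Or.inr (Or.inl (Or.inl h)))
    · have hr₂ := three_le_finrank_of_not_minorsVanish W₂ (h₂ 0) (h₂ 1) (h₂ 2) v₂
      by_cases hp : RowsProportional B₁ (X 0) (X 2) ∧ RowsProportional B₁ (X 1) (X 2)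
      · exact ⟨1, 3, 1, one_le_finrank_of_monomialRow W₁ (by omega) (hX0 0) (h₁ 0), hr₂,
          deg (by omega) hp, le_rfl⟩
      · exact ⟨2, 3, 2, two h₁ hp, hr₂, trdeg_le_of_not_algebraicIndependent X hX
          (not_algebraicIndependent_of_minorsVanish hB₁ hX0 v₁), le_rfl⟩
  · have hr₁ := three_le_finrank_of_not_minorsVanish W₁ (h₁ 0) (h₁ 1) (h₁ 2) v₁
    by_cases v₂ : MinorsVanish B₂ (X 0) (X 1) (X 2)
    · by_cases hp : RowsProportional B₂ (X 0) (X 2) ∧ RowsProportional B₂ (X 1) (X 2)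
      · exact ⟨3, 1, 1, hr₁, one_le_finrank_of_monomialRow W₂ (by omega) (hX0 0) (h₂ 0),
          deg (by omega) hp, le_rfl⟩
      · exact ⟨3, 2, 2, hr₁, two h₂ hp, trdeg_le_of_not_algebraicIndependent X hX
          (not_algebraicIndependent_of_minorsVanish hB₂ hX0 v₂), le_rfl⟩
    · exact ⟨3, 3, 3, hr₁, three_le_finrank_of_not_minorsVanish W₂ (h₂ 0) (h₂ 1) (h₂ 2) v₂,
        trdeg_le_of_adjoin_eq_top X hX, le_rfl⟩

end Bounds

/-! ### The codimension estimates. -/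

theorem codim_one_root (hB₁ : 2 ≤ B₁.card) (hB₂ : 2 ≤ B₂.card) :
    CodimAtLeast 1 (generalFiltration B₁ B₂ 0 0 ![1] ![1]) := by
  refine codimAtLeast_of_irreducible fun Y hYN hY => ?_
  obtain ⟨K, _, _, X, W₁, W₂, hX0, -, hX, h₁, h₂, -, -, -, -, -, -, key⟩ :=
    exists_generic_relations (Finset.card_pos.1 (by omega)) (Finset.card_pos.1 (by omega)) hY hYN
  exact key 1 1 1 1 (one_le_finrank_of_monomialRow W₁ hB₁ (hX0 0) (h₁ 0))
    (one_le_finrank_of_monomialRow W₂ hB₂ (hX0 0) (h₂ 0)) (trdeg_le_of_adjoin_eq_top X hX) le_rfl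

theorem codim_two_roots (hB₁ : 2 ≤ B₁.card) (hB₂ : 2 ≤ B₂.card)
    (hcond : ¬ CondOne B₁ B₂) :
    CodimAtLeast 2 (generalFiltration B₁ B₂ 0 0 ![1, 1] ![1, 1]) := by
  refine codimAtLeast_of_irreducible fun Y hYN hY => ?_
  obtain ⟨K, _, _, X, W₁, W₂, hX0, hinj, hX, h₁, h₂, -, -, -, -, -, -, key⟩ :=
    exists_generic_relations (Finset.card_pos.1 (by omega)) (Finset.card_pos.1 (by omega)) hY hYN
  obtain ⟨r₁, r₂, t, hr₁, hr₂, ht, hle⟩ :=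
    exists_bound_two_roots hB₁ hB₂ hcond hX hX0 hinj h₁ h₂
  exact key r₁ r₂ t 2 hr₁ hr₂ ht hle

theorem codim_boundary (hB₁ : 2 ≤ B₁.card) (hB₂ : 2 ≤ B₂.card)
    (j₀ jInf : ℕ) (hj : 1 ≤ j₀ ∨ 1 ≤ jInf) :
    CodimAtLeast 2 (generalFiltration B₁ B₂ j₀ jInf ![] ![]) := by
  refine codimAtLeast_of_irreducible fun Y hYN hY => ?_
  obtain ⟨K, _, _, X, W₁, W₂, hX0, hinj, hX, -, -, -, -, h0, hInf, -, -, key⟩ :=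
    exists_generic_relations (Finset.card_pos.1 (by omega)) (Finset.card_pos.1 (by omega)) hY hYN
  obtain ⟨⟨e₁, he₁⟩, ⟨e₂, he₂⟩⟩ := hj.elim h0 hInf
  -- No roots are adjoined, so the transcendence degree is 0.
  exact key 1 1 0 2 (one_le_finrank_of_ne_zero W₁ he₁ e₁.2 (by simp))
    (one_le_finrank_of_ne_zero W₂ he₂ e₂.2 (by simp)) (trdeg_le_of_adjoin_eq_top X hX) le_rfl

theorem codim_boundary_one_root (hB₁ : 2 ≤ B₁.card) (hB₂ : 2 ≤ B₂.card)
    (j₀ jInf : ℕ) (hj : 1 ≤ j₀ ∨ 1 ≤ jInf) :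
    CodimAtLeast 3 (generalFiltration B₁ B₂ j₀ jInf ![1] ![1]) := by
  refine codimAtLeast_of_irreducible fun Y hYN hY => ?_
  obtain ⟨K, _, _, X, W₁, W₂, hX0, hinj, hX, h₁, h₂, -, -, h0, hInf, -, -, key⟩ :=
    exists_generic_relations (Finset.card_pos.1 (by omega)) (Finset.card_pos.1 (by omega)) hY hYN
  obtain ⟨⟨e₁, he₁⟩, ⟨e₂, he₂⟩⟩ := hj.elim h0 hInf
  exact key 2 2 1 3 (two_le_finrank_of_single W₁ hB₁ (hX0 0) (h₁ 0) he₁)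
    (two_le_finrank_of_single W₂ hB₂ (hX0 0) (h₂ 0) he₂) (trdeg_le_of_adjoin_eq_top X hX) le_rfl

theorem codim_common_double_root (hB₁ : 2 ≤ B₁.card) (hB₂ : 2 ≤ B₂.card) :
    CodimAtLeast 3 (generalFiltration B₁ B₂ 0 0 ![2] ![2]) := by
  refine codimAtLeast_of_irreducible fun Y hYN hY => ?_
  obtain ⟨K, _, _, X, W₁, W₂, hX0, -, hX, h₁, h₂, hd₁, hd₂, -, -, -, -, key⟩ :=
    exists_generic_relations (Finset.card_pos.1 (by omega)) (Finset.card_pos.1 (by omega)) hY hYN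
  have hchar : CharZero K := charZero_of_injective_algebraMap (algebraMap ℂ K).injective
  exact key 2 2 1 3 (two_le_finrank_of_derivRow W₁ hB₁ (hX0 0) (h₁ 0) (hd₁ 0 le_rfl))
    (two_le_finrank_of_derivRow W₂ hB₂ (hX0 0) (h₂ 0) (hd₂ 0 le_rfl))
    (trdeg_le_of_adjoin_eq_top X hX) le_rfl

theorem codim_double_root_left (hB₁ : 2 ≤ B₁.card) (hB₂ : 2 ≤ B₂.card)
    (hcond : ¬ CondOne B₁ B₂) :
    CodimAtLeast 3 (generalFiltration B₁ B₂ 0 0 ![2, 1] ![1, 1]) := by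
  refine codimAtLeast_of_irreducible fun Y hYN hY => ?_
  obtain ⟨K, _, _, X, W₁, W₂, hX0, hinj, hX, h₁, h₂, hd₁, -, -, -, htop, -, key⟩ :=
    exists_generic_relations (Finset.card_pos.1 (by omega)) (Finset.card_pos.1 (by omega)) hY hYN
  obtain ⟨r₁, r₂, t, hr₁, hr₂, ht, hle⟩ :=
    exists_bound_double_root hB₁ hB₂ hcond hX hX0 hinj h₁ h₂ (hd₁ 0 le_rfl) htop
  exact key r₁ r₂ t 3 hr₁ hr₂ ht hle

theorem codim_double_root_right (hB₁ : 2 ≤ B₁.card) (hB₂ : 2 ≤ B₂.card)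
    (hcond : ¬ CondOne B₁ B₂) :
    CodimAtLeast 3 (generalFiltration B₁ B₂ 0 0 ![1, 1] ![2, 1]) := by
  refine codimAtLeast_of_irreducible fun Y hYN hY => ?_
  obtain ⟨K, _, _, X, W₁, W₂, hX0, hinj, hX, h₁, h₂, -, hd₂, -, -, -, htop, key⟩ :=
    exists_generic_relations (Finset.card_pos.1 (by omega)) (Finset.card_pos.1 (by omega)) hY hYN
  obtain ⟨r₂, r₁, t, hr₂, hr₁, ht, hle⟩ :=
    exists_bound_double_root hB₂ hB₁ (fun h => hcond h.symm) hX hX0 hinj h₂ h₁ (hd₂ 0 le_rfl) htop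
  exact key r₁ r₂ t 3 hr₁ hr₂ ht (by omega)

theorem codim_three_roots (hB₁ : 2 ≤ B₁.card) (hB₂ : 2 ≤ B₂.card)
    (hcond : ¬ (CondOne B₁ B₂ ∨ CondTwo B₁ B₂ ∨ CondThree B₁ B₂ ∨
      CondFour B₁ B₂ ∨ CondFive B₁ B₂)) :
    CodimAtLeast 3 (generalFiltration B₁ B₂ 0 0 ![1, 1, 1] ![1, 1, 1]) := by
  refine codimAtLeast_of_irreducible fun Y hYN hY => ?_
  have hne₁ : B₁.Nonempty := Finset.card_pos.1 (by omega)
  have hne₂ : B₂.Nonempty := Finset.card_pos.1 (by omega)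
  -- A single pair in `Y` shows that both supports have length more than 2. A two-element support
  -- would then be condition 5, so both have at least three elements.
  obtain ⟨F, hF⟩ := hY.1
  obtain ⟨hf₁, hf₂, -, -, x, hx, hx0, hroot, -⟩ := hYN hF
  have hlen₁ : ¬ ∀ b ∈ B₁, ∀ b' ∈ B₁, b - b' ≤ 2 := fun h =>
    hf₁ (eq_zero_of_three_roots h hx hx0 fun j => (hroot j).1)
  have hlen₂ : ¬ ∀ b ∈ B₂, ∀ b' ∈ B₂, b - b' ≤ 2 := fun h =>
    hf₂ (eq_zero_of_three_roots h hx hx0 fun j => (hroot j).2)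
  have long : ∀ {B : Finset ℤ}, B.Nonempty → (¬ ∀ b ∈ B, ∀ b' ∈ B, b - b' ≤ 2) →
      2 < highest B - lowest B := by
    intro B hB h
    by_contra hle
    refine h fun b hb b' hb' => ?_
    have := (highest_mem hB).2 b hb
    have := (lowest_mem hB).2 b' hb'
    omega
  have hc₁ : B₁.card ≠ 2 := fun h =>
    hcond (Or.inr (Or.inr (Or.inr (Or.inr (Or.inl ⟨h, long hne₂ hlen₂⟩)))))
  have hc₂ : B₂.card ≠ 2 := fun h =>
    hcond (Or.inr (Or.inr (Or.inr (Or.inr (Or.inr ⟨h, long hne₁ hlen₁⟩)))))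
  obtain ⟨K, _, _, X, W₁, W₂, hX0, hinj, hX, h₁, h₂, -, -, -, -, -, -, key⟩ :=
    exists_generic_relations hne₁ hne₂ hY hYN
  obtain ⟨r₁, r₂, t, hr₁, hr₂, ht, hle⟩ :=
    exists_bound_three_roots (by omega) (by omega) (by tauto) hlen₁ hX hX0 hinj h₁ h₂
  exact key r₁ r₂ t 3 hr₁ hr₂ ht hle

end SparseResultant

theorem theorem4p12 (B₁ B₂ : Finset ℤ) (hB₁ : 2 ≤ B₁.card) (hB₂ : 2 ≤ B₂.card) :
    -- N(1)
    SparseResultant.CodimAtLeast 1 (SparseResultant.symmetricFiltration B₁ B₂ 0 0 ![1]) ∧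
    -- N(1, 1)
    (¬ SparseResultant.CondOne B₁ B₂ →
      SparseResultant.CodimAtLeast 2 (SparseResultant.symmetricFiltration B₁ B₂ 0 0 ![1, 1])) ∧
    -- lower index 1, upper index 0, no further roots
    SparseResultant.CodimAtLeast 2 (SparseResultant.symmetricFiltration B₁ B₂ 1 0 ![]) ∧
    -- lower index 0, upper index 1, no further roots
    SparseResultant.CodimAtLeast 2 (SparseResultant.symmetricFiltration B₁ B₂ 0 1 ![]) ∧
    -- N(2)
    SparseResultant.CodimAtLeast 3 (SparseResultant.symmetricFiltration B₁ B₂ 0 0 ![2]) ∧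
    -- N(1, 1, 1)
    (¬ (SparseResultant.CondOne B₁ B₂ ∨ SparseResultant.CondTwo B₁ B₂ ∨
        SparseResultant.CondThree B₁ B₂ ∨ SparseResultant.CondFour B₁ B₂ ∨
        SparseResultant.CondFive B₁ B₂) →
      SparseResultant.CodimAtLeast 3 (SparseResultant.symmetricFiltration B₁ B₂ 0 0 ![1, 1, 1])) ∧
    -- lower index 0, upper index 1, one further root
    SparseResultant.CodimAtLeast 3 (SparseResultant.symmetricFiltration B₁ B₂ 0 1 ![1]) ∧
    -- lower index 1, upper index 0, one further root
    SparseResultant.CodimAtLeast 3 (SparseResultant.symmetricFiltration B₁ B₂ 1 0 ![1]) ∧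
    -- rows (2, 1) and (1, 1)
    (¬ SparseResultant.CondOne B₁ B₂ →
      SparseResultant.CodimAtLeast 3
        (SparseResultant.generalFiltration B₁ B₂ 0 0 ![2, 1] ![1, 1])) ∧
    -- rows (1, 1) and (2, 1)
    (¬ SparseResultant.CondOne B₁ B₂ →
      SparseResultant.CodimAtLeast 3
        (SparseResultant.generalFiltration B₁ B₂ 0 0 ![1, 1] ![2, 1])) := by
  simp only [SparseResultant.symmetricFiltration_eq]
  exact ⟨SparseResultant.codim_one_root hB₁ hB₂, SparseResultant.codim_two_roots hB₁ hB₂,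
    SparseResultant.codim_boundary hB₁ hB₂ 1 0 (Or.inl le_rfl), SparseResultant.codim_boundary hB₁ hB₂ 0 1 (Or.inr le_rfl),
    SparseResultant.codim_common_double_root hB₁ hB₂, SparseResultant.codim_three_roots hB₁ hB₂,
    SparseResultant.codim_boundary_one_root hB₁ hB₂ 0 1 (Or.inr le_rfl),
    SparseResultant.codim_boundary_one_root hB₁ hB₂ 1 0 (Or.inl le_rfl),
    SparseResultant.codim_double_root_left hB₁ hB₂, SparseResultant.codim_double_root_right hB₁ hB₂⟩
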